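/- Let $E$ be a Dedekind complete Riesz space with weak order unit $e$, let $T$ be a conditional expectation on $E$, that is, a strictly positive, order continuous linear projection with $Te=e$ and Dedekind complete range, and let $S$ be an order continuous Riesz homomorphism on $E$ with $Se=e$ and $TS=T$. Let $E^u$ be the universal completion of $E$, and let powers $x^r$ ($x\in E^u_+$, $r>0$) be those of the functional calculus of $E^u$ with unit $e$. Let $L^1(T)=D-D$, where $D$ is the set of those $x\in E^u_+$ for which there is a net $(x_\alpha)$ in $E_+$ with $x_\alpha\uparrow x$ and $(Tx_\alpha)$ order bounded in $E^u$. Extend $R\in\{T,S\}$ to $L^1(T)$ by $Rx=\sup_\alpha Rx_\alpha$ if $x\in D$ and $(x_\alpha)$ is a net in $E_+$ with $x_\alpha\uparrow x$, and by $Rx=Rx^+-Rx^-$ in general, and let $R(T)=T(L^1(T))$. For $1\le q<\infty$ put $$L^q(T)=\{x\in L^1(T): |x|^q\in L^1(T)\},\qquad \|x\|_{T,q}=\bigl(T|x|^q\bigr)^{1/q},$$ and put $$L^\infty(T)=\{x\in L^1(T): |x|\le u \text{ for some } u\in R(T)\},\qquad \|x\|_{T,\infty}=\inf\{u\in R(T):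 |x|\le u\}.$$ Then for every $q\in[1,\infty]$ the space $L^q(T)$ is invariant under $S$, and $S$ is an isometry of $L^q(T)$ for the $R(T)$-valued norm $\|\cdot\|_{T,q}$: if $x\in L^q(T)$, then $Sx$ is defined, $Sx\in L^q(T)$, $\|x\|_{T,q}\in R(T)$, and $$\|Sx\|_{T,q}=\|x\|_{T,q}.$$ -/

import Mathlib

namespace RieszErgodic

noncomputable section

section Systems

/-! A Dedekind complete Riesz space is a real vector space with the classes
`AddCommGroup`, `ConditionallyCompleteLattice`, `IsOrderedAddMonoid`, `Module ℝ`,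
`IsOrderedModule ℝ`. -/

variable {E : Type*} [AddCommGroup E] [ConditionallyCompleteLattice E] [Module ℝ E]

/-- `e` is a weak order unit: `e ≥ 0` and only `0` is disjoint from `e`. -/
def IsWeakOrderUnit (e : E) : Prop :=
  0 ≤ e ∧ ∀ x : E, e ⊓ |x| = 0 → x = 0

/-- Order continuity of a positive operator: `x_α ↓ 0` implies `R x_α ↓ 0`.
Decreasing nets are given by their ranges, nonempty downward directed sets. -/
def IsOrderContinuous (R : E →ₗ[ℝ] E) : Prop :=
  ∀ A : Set E, A.Nonempty → DirectedOn (· ≥ ·) A → IsGLB A 0 → IsGLB (R '' A) 0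

/-- `(E, e, T)` is a conditional Riesz triple: `e` is a weak order unit and `T` is a strictly
positive order continuous linear projection with `T e = e` and Dedekind complete range. -/
structure IsConditionalRieszTriple (e : E) (T : E →ₗ[ℝ] E) : Prop where
  weakUnit : IsWeakOrderUnit e
  strictlyPositive : ∀ x : E, 0 < x → 0 < T x
  orderContinuous : IsOrderContinuous T
  projection : ∀ x : E, T (T x) = T x
  map_unit : T e = e
  range_complete : ∀ A : Set (LinearMap.range T), A.Nonempty → BddAbove A → ∃ s, IsLUB A s

/-- `(E, T, S, e)` is a conditional expectation preserving system: `(E, e, T)` is a conditional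
Riesz triple and `S` is an order continuous Riesz homomorphism with `S e = e`, `T S = T`. -/
structure IsCondExpPreservingSystem (e : E) (T S : E →ₗ[ℝ] E) : Prop where
  triple : IsConditionalRieszTriple e T
  map_sup : ∀ x y : E, S (x ⊔ y) = S x ⊔ S y
  orderContinuous : IsOrderContinuous S
  map_unit : S e = e
  preserving : ∀ x : E, T (S x) = T x

end Systems

section Completion

variable {E : Type*} [AddCommGroup E] [ConditionallyCompleteLattice E] [Module ℝ E]
variable {U : Type*} [AddCommGroup U] [ConditionallyCompleteLattice U] [Module ℝ U]

/-- The Dedekind complete Riesz space `U`, with the embedding `i`, is a universal completion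
of `E`: `U` is laterally complete (every nonempty set of pairwise disjoint positive elements
has a supremum), and `i` is an injective Riesz homomorphism with order dense range. -/
structure IsUniversalCompletion (i : E →ₗ[ℝ] U) : Prop where
  injective : Function.Injective i
  map_sup : ∀ x y : E, i (x ⊔ y) = i x ⊔ i y
  orderDense : ∀ u : U, 0 < u → ∃ x : E, 0 < x ∧ i x ≤ u
  laterallyComplete : ∀ A : Set U, A.Nonempty → (∀ a ∈ A, 0 ≤ a) →
    (∀ a ∈ A, ∀ b ∈ A, a ≠ b → a ⊓ b = 0) → ∃ s, IsLUB A s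

/-- The images under `R` of the positive elements of `E` below `x`. The positive elements of `E`
below `x ≥ 0` form an upward directed set with supremum `x`. -/
def imagesBelow (i : E →ₗ[ℝ] U) (R : E →ₗ[ℝ] E) (x : U) : Set U :=
  {v | ∃ y : E, 0 ≤ y ∧ i y ≤ x ∧ v = i (R y)}

/-- The extension of the positive operator `R` is defined at `x`: the suprema in `E^u`
defining it at `x⁺` and at `x⁻` exist. -/
def ExtendsTo (i : E →ₗ[ℝ] U) (R : E →ₗ[ℝ] E) (x : U) : Prop :=
  BddAbove (imagesBelow i R x⁺) ∧ BddAbove (imagesBelow i R x⁻)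

/-- The extension of a positive order continuous operator `R` on `E` to elements of `E^u`:
`R x = sup R x_α` for nets `x_α ↑ x` in `E₊` if `x ≥ 0`, and `R x = R x⁺ - R x⁻` in general. -/
def extend (i : E →ₗ[ℝ] U) (R : E →ₗ[ℝ] E) (x : U) : U :=
  sSup (imagesBelow i R x⁺) - sSup (imagesBelow i R x⁻)

/-- The positive cone of the natural domain of `T`: those `x ≥ 0` in `E^u` for which there is
a net `x_α ↑ x` in `E₊` with `(T x_α)` order bounded in `E^u`. -/
def domCone (i : E →ₗ[ℝ] U) (T : E →ₗ[ℝ] E) : Set U :=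
  {x | 0 ≤ x ∧ ∃ A : Set E, A.Nonempty ∧ DirectedOn (· ≤ ·) A ∧ (∀ a ∈ A, 0 ≤ a) ∧
    IsLUB (i '' A) x ∧ BddAbove ((fun a => i (T a)) '' A)}

/-- The natural domain `L¹(T)` of `T`. -/
def L1 (i : E →ₗ[ℝ] U) (T : E →ₗ[ℝ] E) : Set U :=
  {x | ∃ a ∈ domCone i T, ∃ b ∈ domCone i T, x = a - b}

/-- The range `R(T)` of `T` on `L¹(T)`. -/
def condRange (i : E →ₗ[ℝ] U) (T : E →ₗ[ℝ] E) : Set U :=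
  extend i T '' L1 i T

/-- `p` is a component of `w`. -/
def IsComponent (w p : U) : Prop :=
  p ⊓ (w - p) = 0

/-- The `q`-th powers `t ^ q • p` of the multiples `t • p ≤ x` (`t ≥ 0`) of components `p`
of the unit `w`. -/
def stepPowers (w : U) (q : ℝ) (x : U) : Set U :=
  {v | ∃ (t : ℝ) (p : U), 0 ≤ t ∧ IsComponent w p ∧ t • p ≤ x ∧ v = t ^ q • p}

/-- The power `x ^ q` (`x ≥ 0`, `q > 0`) of the functional calculus of `E^u` with unit `w`: the
supremum of the powers of step elements below `x`. (In the representation of `E^u` as a space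
of extended real valued functions with `w = 1`, it is the pointwise power.) -/
def power (w : U) (q : ℝ) (x : U) : U :=
  sSup (stepPowers w q x)

/-- `L^q(T) = {x ∈ L¹(T) : |x|^q ∈ L¹(T)}`. -/
def Lq (i : E →ₗ[ℝ] U) (e : E) (T : E →ₗ[ℝ] E) (q : ℝ) : Set U :=
  {x | x ∈ L1 i T ∧ BddAbove (stepPowers (i e) q |x|) ∧ power (i e) q |x| ∈ L1 i T}

/-- The norm `‖x‖_{T,q} = (T |x|^q)^{1/q}` on `L^q(T)`. -/
def normLq (i : E →ₗ[ℝ] U) (e : E) (T : E →ₗ[ℝ] E) (q : ℝ) (x : U) : U :=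
  power (i e) (1 / q) (extend i T (power (i e) q |x|))

/-- `L^∞(T) = {x ∈ L¹(T) : |x| ≤ u for some u ∈ R(T)}`. -/
def LInfty (i : E →ₗ[ℝ] U) (T : E →ₗ[ℝ] E) : Set U :=
  {x | x ∈ L1 i T ∧ ∃ u ∈ condRange i T, |x| ≤ u}

/-- The norm `‖x‖_{T,∞} = inf {u ∈ R(T) : |x| ≤ u}` on `L^∞(T)`. -/
def normLInfty (i : E →ₗ[ℝ] U) (T : E →ₗ[ℝ] E) (x : U) : U :=
  sInf {u | u ∈ condRange i T ∧ |x| ≤ u}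

end Completion

end

end RieszErgodic

set_option linter.unusedSectionVars false

/-! The heart is `T S = T`, carried along nets to the natural domain of `T` (`isPosExtension_comp`).
As `S` is a Riesz homomorphism fixing the unit, its extension commutes with `|·|` and with powers
(`extend_mem_L1`, `isLUB_stepPowers`), so `T|Sx|^q = T S|x|^q = T|x|^q`.

Three points need work. The supremum defining `Sx` must exist: were the images of the elements below
`x` to exhaust every multiple of some `z > 0`, then `n • T z ≤ T x` for all `n`, against strict
positivity; lateral completeness turns the resulting local bounds into a global one. The norm must
lie in `R(T)`, whose positive elements are exactly the `T`-fixed ones; this class is closed under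
infima and under powers with exponent at most one (`fixed_of_isGLB`, `fixed_power`). For `q = ∞`,
`S` must fix the positive elements of `R(T)` (`fixed_of_fixed`): strict positivity gives this for
`T`-fixed components of `e`, and a Freudenthal argument passes to the rest. Then `|x|` and `|Sx|`
have the same upper bounds in `R(T)`. -/

namespace RieszErgodic

/-! ### Order identities in lattice-ordered groups. -/

section Lattice

variable {U : Type*} [AddCommGroup U] [ConditionallyCompleteLattice U] [IsOrderedAddMonoid U]

lemma le_of_sub_eq {a b c d : U} (h : a ≤ b) (e : d - c = b - a) : c ≤ d :=
  sub_nonneg.1 (e ▸ sub_nonneg.2 h)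

/-- Since `f` drops by at most `a - b` from `a` to `b`, an upper bound `c` of the image forces `b ≤
a + c - f a` for every `b ∈ A`. -/
lemma isLUB_image_of_monotone {A : Set U} {a : U} (hA : IsLUB A a) {f : U → U} (hf : Monotone f)
    (hl : ∀ b ≤ a, f a ≤ f b + (a - b)) : IsLUB (f '' A) (f a) := by
  refine ⟨?_, fun c hc => ?_⟩
  · rintro _ ⟨b, hb, rfl⟩
    exact hf (hA.1 hb)
  · have h : a ≤ a + c - f a := hA.2 fun b hb =>
      le_of_sub_eq (add_le_add (hc ⟨b, hb, rfl⟩) (hl b (hA.1 hb))) (by abel)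
    exact le_of_sub_eq h (by abel)

lemma inf_le_inf_add_sub {a b : U} (h : b ≤ a) (c : U) : a ⊓ c ≤ b ⊓ c + (a - b) := by
  rw [inf_add]
  exact le_inf (inf_le_left.trans (le_of_eq (by abel)))
    (inf_le_right.trans (le_add_of_nonneg_right (sub_nonneg.2 h)))

lemma isLUB_image_inf {A : Set U} {a : U} (hA : IsLUB A a) (c : U) :
    IsLUB ((fun x => x ⊓ c) '' A) (a ⊓ c) :=
  isLUB_image_of_monotone hA (f := fun x => x ⊓ c) (fun _ _ h => inf_le_inf_right c h)
    fun _ h => inf_le_inf_add_sub h c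

lemma inf_le_of_isLUB {A : Set U} {a b c : U} (hA : IsLUB A a) (h : ∀ x ∈ A, x ⊓ b ≤ c) :
    a ⊓ b ≤ c :=
  (isLUB_image_inf hA b).2 (by rintro _ ⟨x, hx, rfl⟩; exact h x hx)

lemma add_inf_le_add {a b c : U} (ha : 0 ≤ a) (hb : 0 ≤ b) (hc : 0 ≤ c) :
    (a + b) ⊓ c ≤ a ⊓ c + b ⊓ c := by
  rw [add_inf, inf_add, inf_add]
  refine le_inf (le_inf inf_le_left ?_) (le_inf ?_ ?_)
  · exact inf_le_right.trans (le_add_of_nonneg_right hb)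
  · exact inf_le_right.trans (le_add_of_nonneg_left ha)
  · exact inf_le_right.trans (le_add_of_nonneg_left hc)

lemma inf_eq_zero_mono {a b c d : U} (h : a ⊓ b = 0) (hc : 0 ≤ c) (hd : 0 ≤ d) (hca : c ≤ a)
    (hdb : d ≤ b) : c ⊓ d = 0 :=
  le_antisymm ((inf_le_inf hca hdb).trans h.le) (le_inf hc hd)

lemma sub_inf_eq_posPart_sub (a b : U) : a - a ⊓ b = (a - b)⁺ := by
  rw [posPart_def, sub_inf, sub_self, sup_comm]

lemma posPart_sub_pos_of_not_le {a b : U} (h : ¬ a ≤ b) : 0 < (a - b)⁺ := by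
  refine lt_of_le_of_ne (posPart_nonneg _) fun h0 => h ?_
  exact sub_nonpos.1 (posPart_eq_zero.1 h0.symm)

lemma posPart_le_of_le {a b : U} (h : a ≤ b) (hb : 0 ≤ b) : a⁺ ≤ b := sup_le h hb

lemma posPart_add_inf_posPart_eq_zero {a b : U} (h : a ⊓ b ≤ 0) : a⁺ ⊓ b⁺ = 0 := by
  have : (a ⊓ b)⁺ = a⁺ ⊓ b⁺ := by
    let := AddCommGroup.toDistribLattice U
    exact posPart_min a b
  rw [← this]
  exact posPart_eq_zero.2 h

lemma posPart_sub_eq_of_disjoint {a b : U} (h : a ⊓ b = 0) : (a - b)⁺ = a := by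
  rw [← sub_inf_eq_posPart_sub, h, sub_zero]

lemma negPart_sub_eq_of_disjoint {a b : U} (h : a ⊓ b = 0) : (a - b)⁻ = b := by
  rw [← posPart_neg, neg_sub, posPart_sub_eq_of_disjoint (by rwa [inf_comm])]

lemma add_eq_sup_of_disjoint {a b : U} (h : a ⊓ b = 0) : a + b = a ⊔ b := by
  rw [← inf_add_sup, h, zero_add]

end Lattice

/-! ### Archimedean property, disjointness and lateral completeness. -/

section Module

variable {U : Type*} [AddCommGroup U] [ConditionallyCompleteLattice U] [IsOrderedAddMonoid U]
  [Module ℝ U] [IsOrderedModule ℝ U]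

/-- Dedekind completeness gives the Archimedean property: the supremum `s` of the multiples
satisfies `s + x ≤ s`. -/
lemma nonpos_of_forall_natCast_smul_le {x y : U} (h : ∀ n : ℕ, (n : ℝ) • x ≤ y) : x ≤ 0 := by
  have hne : (Set.range fun n : ℕ => (n : ℝ) • x).Nonempty := ⟨_, 0, rfl⟩
  have hb : BddAbove (Set.range fun n : ℕ => (n : ℝ) • x) := ⟨y, by rintro _ ⟨n, rfl⟩; exact h n⟩
  have hl := isLUB_csSup hne hb
  set s := sSup (Set.range fun n : ℕ => (n : ℝ) • x)
  have : s ≤ s - x := hl.2 (by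
    rintro _ ⟨n, rfl⟩
    have := hl.1 ⟨n + 1, rfl⟩
    exact le_of_sub_eq this (by push_cast; module))
  exact le_of_sub_eq this (by abel)

lemma natCast_smul_inf_eq_zero {a b : U} (hb : 0 ≤ b) (h : a ⊓ b = 0) (n : ℕ) :
    ((n : ℝ) • a) ⊓ b = 0 := by
  have ha : 0 ≤ a := h ▸ inf_le_left
  induction n with
  | zero => simpa using hb
  | succ n ih =>
    have hn : 0 ≤ (n : ℝ) • a := smul_nonneg n.cast_nonneg ha
    have : ((n + 1 : ℕ) : ℝ) • a = (n : ℝ) • a + a := by push_cast; module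
    rw [this]
    refine le_antisymm ?_ (le_inf (add_nonneg hn ha) hb)
    simpa [ih, h] using add_inf_le_add hn ha hb

lemma smul_inf_eq_zero {a b : U} (h : a ⊓ b = 0) {r : ℝ} (hr : 0 ≤ r) : (r • a) ⊓ b = 0 := by
  have ha : 0 ≤ a := h ▸ inf_le_left
  have hb : 0 ≤ b := h ▸ inf_le_right
  obtain ⟨n, hn⟩ := exists_nat_ge r
  exact inf_eq_zero_mono (natCast_smul_inf_eq_zero hb h n) (smul_nonneg hr ha) hb
    (smul_le_smul_of_nonneg_right hn ha) le_rfl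

lemma inf_smul_eq_zero {a b : U} (h : a ⊓ b = 0) {r : ℝ} (hr : 0 ≤ r) : a ⊓ (r • b) = 0 := by
  rw [inf_comm] at h ⊢
  exact smul_inf_eq_zero h hr

/-- The hypothesis says that `s` dominates `x` on the band of `d`. The common part `c` turns out to
be disjoint from `(n • c - s)⁺`, which lies below `n • c` and so vanishes; thus `n • c ≤ s` for all
`n`. -/
lemma posPart_sub_inf_eq_zero {x s d : U} (hx : 0 ≤ x) (hd : 0 ≤ d)
    (h : ∀ n : ℕ, x ⊓ (n : ℝ) • d ≤ s) : (x - s)⁺ ⊓ d = 0 := by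
  have hs : 0 ≤ s := by simpa [hx] using h 0
  set c := (x - s)⁺ ⊓ d
  have hc0 : 0 ≤ c := le_inf (posPart_nonneg _) hd
  refine le_antisymm (nonpos_of_forall_natCast_smul_le (y := s) fun n => ?_) hc0
  have h1 : (x - s)⁺ ⊓ ((n : ℝ) • d - s)⁺ = 0 :=
    posPart_add_inf_posPart_eq_zero (by
      rw [← inf_sub]
      exact sub_nonpos.2 (h n))
  have hcd : (n : ℝ) • c ≤ (n : ℝ) • d := smul_le_smul_of_nonneg_left inf_le_right n.cast_nonneg
  have hnc : 0 ≤ (n : ℝ) • c := smul_nonneg n.cast_nonneg hc0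
  have h2 : c ⊓ ((n : ℝ) • c - s)⁺ = 0 :=
    inf_eq_zero_mono h1 hc0 (posPart_nonneg _) inf_le_left
      (posPart_mono (sub_le_sub_right hcd s))
  have h3 := smul_inf_eq_zero h2 (r := n) n.cast_nonneg
  rw [inf_eq_right.2 (posPart_le_of_le (sub_le_self _ hs) hnc)] at h3
  exact sub_nonpos.1 (posPart_eq_zero.1 h3)

/-- In a laterally complete space, a set of positive elements is bounded above if every band
contains a nonzero element on whose band the set is bounded above. -/
lemma bddAbove_of_laterallyComplete
    (hlat : ∀ A : Set U, A.Nonempty → (∀ a ∈ A, 0 ≤ a) →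
      (∀ a ∈ A, ∀ b ∈ A, a ≠ b → a ⊓ b = 0) → ∃ s, IsLUB A s)
    {Y : Set U} (hY : ∀ y ∈ Y, 0 ≤ y)
    (h : ∀ c : U, 0 < c → ∃ d, 0 < d ∧ d ≤ c ∧ ∃ b, ∀ y ∈ Y, ∀ n : ℕ, y ⊓ (n : ℝ) • d ≤ b) :
    BddAbove Y := by
  obtain rfl | hYne := Y.eq_empty_or_nonempty
  · exact bddAbove_empty
  let good : U → Prop := fun d => 0 < d ∧ ∃ b, ∀ y ∈ Y, ∀ n : ℕ, y ⊓ (n : ℝ) • d ≤ b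
  let F : Set (Set U) :=
    {D | (∀ d ∈ D, good d) ∧ ∀ a ∈ D, ∀ b ∈ D, a ≠ b → a ⊓ b = 0}
  -- A maximal disjoint family of elements on whose bands `Y` is bounded.
  obtain ⟨D, hD⟩ := zorn_subset F (by
    intro c hc hch
    refine ⟨⋃₀ c, ⟨?_, ?_⟩, fun s hs => Set.subset_sUnion_of_mem hs⟩
    · rintro d ⟨s, hs, hd⟩
      exact (hc hs).1 d hd
    · rintro a ⟨s, hs, ha⟩ b ⟨t, ht, hb⟩ hab
      obtain hst | hts := hch.total hs ht
      · exact (hc ht).2 a (hst ha) b hb hab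
      · exact (hc hs).2 a ha b (hts hb) hab)
  -- The supremum of `K d` is the least bound of the projections of `Y` to the band of `d`.
  let K : U → Set U := fun d => {v | ∃ y ∈ Y, ∃ n : ℕ, v = y ⊓ (n : ℝ) • d}
  have hK : ∀ d ∈ D, IsLUB (K d) (sSup (K d)) := by
    intro d hd
    obtain ⟨y, hy⟩ := hYne
    refine isLUB_csSup ⟨_, y, hy, 0, rfl⟩ ?_
    obtain ⟨b, hb⟩ := (hD.prop.1 d hd).2
    exact ⟨b, by rintro _ ⟨y, hy, n, rfl⟩; exact hb y hy n⟩
  have hK0 : ∀ d ∈ D, 0 ≤ sSup (K d) := by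
    intro d hd
    obtain ⟨y, hy⟩ := hYne
    exact (hK d hd).1 ⟨y, hy, 0, by simp [hY y hy]⟩
  have hdisj : ∀ a ∈ D, ∀ b ∈ D, a ≠ b → sSup (K a) ⊓ sSup (K b) = 0 := by
    intro a ha b hb hab
    refine le_antisymm ?_ (le_inf (hK0 a ha) (hK0 b hb))
    refine inf_le_of_isLUB (hK a ha) ?_
    rintro _ ⟨y, hy, n, rfl⟩
    rw [inf_comm]
    refine inf_le_of_isLUB (hK b hb) ?_
    rintro _ ⟨z, hz, m, rfl⟩
    refine (inf_le_inf inf_le_right inf_le_right).trans (le_of_eq ?_)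
    exact smul_inf_eq_zero (inf_smul_eq_zero (hD.prop.2 b hb a ha hab.symm) n.cast_nonneg)
      m.cast_nonneg
  obtain ⟨s, hs⟩ := hlat (insert 0 ((fun d => sSup (K d)) '' D)) (Set.insert_nonempty _ _)
    (by
      rintro _ (rfl | ⟨d, hd, rfl⟩)
      · exact le_rfl
      · exact hK0 d hd)
    (by
      rintro _ (rfl | ⟨a, ha, rfl⟩) _ (rfl | ⟨b, hb, rfl⟩) hne
      · exact absurd rfl hne
      · exact inf_eq_left.2 (hK0 b hb)
      · exact inf_eq_right.2 (hK0 a ha)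
      · exact hdisj a ha b hb fun h => hne (by rw [h]))
  -- If `y ≤ s` failed, a good element below `(y - s)⁺` would be disjoint from all of `D`, against
  -- maximality.
  refine ⟨s, fun y hy => ?_⟩
  by_contra hys
  have hpos := posPart_sub_pos_of_not_le hys
  obtain ⟨d, hd0, hdle, hdb⟩ := h _ hpos
  have hdd : ∀ d' ∈ D, d' ⊓ d = 0 := by
    intro d' hd'
    have h1 := posPart_sub_inf_eq_zero (hY y hy) (hD.prop.1 d' hd').1.le (s := s) fun n =>
      ((hK d' hd').1 ⟨y, hy, n, rfl⟩).trans (hs.1 (Or.inr ⟨d', hd', rfl⟩))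
    rw [inf_comm] at h1
    exact inf_eq_zero_mono h1 (hD.prop.1 d' hd').1.le hd0.le le_rfl hdle
  have hmem : insert d D ∈ F := by
    refine ⟨?_, ?_⟩
    · rintro _ (rfl | ha)
      · exact ⟨hd0, hdb⟩
      · exact hD.prop.1 _ ha
    · rintro _ (rfl | ha) _ (rfl | hb) hne
      · exact absurd rfl hne
      · rw [inf_comm]; exact hdd _ hb
      · exact hdd _ ha
      · exact hD.prop.2 _ ha _ hb hne
  have : d ∈ D := hD.le_of_ge hmem (Set.subset_insert _ _) (Set.mem_insert _ _)
  have := hdd d this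
  rw [inf_idem] at this
  exact hd0.ne' this

/-! ### Components of the unit and Freudenthal approximation. -/

section Components

/-- The component of `w` on which `x ≥ t • w`. -/
noncomputable def levelComponent (w x : U) (t : ℝ) : U :=
  w - sSup (Set.range fun n : ℕ => w ⊓ (n : ℝ) • (t • w - x)⁺)

lemma IsComponent.nonneg {w p : U} (h : IsComponent w p) : 0 ≤ p := h ▸ inf_le_left

lemma IsComponent.le {w p : U} (h : IsComponent w p) : p ≤ w :=
  sub_nonneg.1 (h ▸ inf_le_right)

lemma isLUB_levelComponent (w x : U) (t : ℝ) :
    IsLUB (Set.range fun n : ℕ => w ⊓ (n : ℝ) • (t • w - x)⁺) (w - levelComponent w x t) := by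
  rw [levelComponent, sub_sub_cancel]
  exact isLUB_csSup ⟨_, 0, rfl⟩ ⟨w, by rintro _ ⟨n, rfl⟩; exact inf_le_left⟩

lemma levelComponent_le {w : U} (hw : 0 ≤ w) (x : U) (t : ℝ) : levelComponent w x t ≤ w := by
  have := (isLUB_levelComponent w x t).1 ⟨0, rfl⟩
  simp only [Nat.cast_zero, zero_smul, inf_eq_right.2 hw] at this
  exact sub_nonneg.1 this

lemma levelComponent_nonneg (w x : U) (t : ℝ) : 0 ≤ levelComponent w x t :=
  sub_le_self_iff w |>.1 ((isLUB_levelComponent w x t).2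
    (by rintro _ ⟨n, rfl⟩; exact inf_le_left))

lemma levelComponent_inf_eq_zero {w : U} (hw : 0 ≤ w) (x : U) (t : ℝ) :
    levelComponent w x t ⊓ (t • w - x)⁺ = 0 := by
  have := posPart_sub_inf_eq_zero hw (posPart_nonneg (t • w - x)) fun n =>
    (isLUB_levelComponent w x t).1 ⟨n, rfl⟩
  rwa [sub_sub_cancel, posPart_of_nonneg (levelComponent_nonneg w x t)] at this

lemma isComponent_levelComponent {w : U} (hw : 0 ≤ w) (x : U) (t : ℝ) :
    IsComponent w (levelComponent w x t) := by
  refine le_antisymm ?_ (le_inf (levelComponent_nonneg _ _ _)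
    (sub_nonneg.2 (levelComponent_le hw _ _)))
  rw [inf_comm]
  refine inf_le_of_isLUB (isLUB_levelComponent w x t) ?_
  rintro _ ⟨n, rfl⟩
  rw [inf_comm]
  exact (inf_le_inf_left _ inf_le_right).trans
    (inf_smul_eq_zero (levelComponent_inf_eq_zero hw x t) n.cast_nonneg).le

lemma smul_levelComponent_le {w x : U} (hw : 0 ≤ w) (hx : 0 ≤ x) {t : ℝ} (ht : 0 ≤ t) :
    t • levelComponent w x t ≤ x := by
  have h1 := smul_inf_eq_zero (levelComponent_inf_eq_zero hw x t) ht
  have h2 : (t • levelComponent w x t - x)⁺ ≤ 0 := by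
    rw [← h1]
    refine le_inf (posPart_le_of_le (sub_le_self _ hx)
      (smul_nonneg ht (levelComponent_nonneg _ _ _))) ?_
    exact posPart_mono (sub_le_sub_right
      (smul_le_smul_of_nonneg_left (levelComponent_le hw x t) ht) x)
  exact sub_nonpos.1 (posPart_eq_zero.1 (le_antisymm h2 (posPart_nonneg _)))

lemma IsComponent.inf_posPart_eq_zero {w p x : U} (hp : IsComponent w p) {t : ℝ} (ht : 0 ≤ t)
    (h : t • p ≤ x) : p ⊓ (t • w - x)⁺ = 0 := by
  refine inf_eq_zero_mono (inf_smul_eq_zero hp ht) hp.nonneg (posPart_nonneg _) le_rfl ?_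
  refine posPart_le_of_le ?_ (smul_nonneg ht (sub_nonneg.2 hp.le))
  rw [smul_sub]
  exact sub_le_sub_left h _

lemma IsComponent.le_of_inf_sub_eq_zero {w p c : U} (hp : IsComponent w p) (hc : 0 ≤ c)
    (hcw : c ≤ w) (h : p ⊓ (w - c) = 0) : p ≤ c := by
  have h1 := add_inf_le_add hc (sub_nonneg.2 hcw) hp.nonneg
  rw [add_sub_cancel, inf_eq_right.2 hp.le, inf_comm (w - c), h, add_zero] at h1
  exact h1.trans inf_le_left

/-- Maximality of the level component: `p` is disjoint from `(t • w - x)⁺`, hence from the part of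
`w` in its band. -/
lemma IsComponent.le_levelComponent {w p x : U} (hp : IsComponent w p) (hw : 0 ≤ w) {t : ℝ}
    (ht : 0 ≤ t) (h : t • p ≤ x) : p ≤ levelComponent w x t := by
  refine hp.le_of_inf_sub_eq_zero (levelComponent_nonneg _ _ _) (levelComponent_le hw _ _) ?_
  refine le_antisymm ?_ (le_inf hp.nonneg (sub_nonneg.2 (levelComponent_le hw _ _)))
  rw [inf_comm]
  refine inf_le_of_isLUB (isLUB_levelComponent w x t) ?_
  rintro _ ⟨n, rfl⟩
  rw [inf_comm]
  exact (inf_le_inf_left _ inf_le_right).trans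
    (inf_smul_eq_zero (hp.inf_posPart_eq_zero ht h) n.cast_nonneg).le

/-- A form of Freudenthal's theorem: an upper bound of the step elements below `x` is an upper
bound of `x`. -/
lemma le_of_forall_smul_levelComponent_le {w : U} (hw : IsWeakOrderUnit w) {x s : U} (hx : 0 ≤ x)
    (h : ∀ t : ℝ, 0 ≤ t → t • levelComponent w x t ≤ s) : x ≤ s := by
  wlog hsx : s ≤ x generalizing s
  · exact (this (s := s ⊓ x) (fun t ht => le_inf (h t ht) (smul_levelComponent_le hw.1 hx ht))
      inf_le_right).trans inf_le_left
  have hd : 0 ≤ x - s := sub_nonneg.2 hsx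
  have key : ∀ ε : ℝ, 0 < ε → levelComponent w (x - s) ε = 0 := by
    intro ε hε
    set b := levelComponent w (x - s) ε
    have hb : IsComponent w b := isComponent_levelComponent hw.1 _ _
    have hb1 : ε • b ≤ x - s := smul_levelComponent_le hw.1 hd hε.le
    -- If `nε • b ≤ x`, then `b` lies in the level component of `x` at `nε`, so `nε • b ≤ s`; adding
    -- `ε • b ≤ x - s` gives the next multiple.
    have hn : ∀ n : ℕ, (n : ℝ) • (ε • b) ≤ x := by
      intro n
      induction n with
      | zero => simpa using hx
      | succ n ih =>
        rw [smul_smul] at ih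
        have ht : 0 ≤ (n : ℝ) * ε := by positivity
        have h1 := (smul_le_smul_of_nonneg_left (hb.le_levelComponent hw.1 ht ih) ht).trans
          (h _ ht)
        exact le_of_sub_eq (add_le_add h1 hb1) (by push_cast; module)
    have h0 := le_antisymm (nonpos_of_forall_natCast_smul_le hn) (smul_nonneg hε.le hb.nonneg)
    exact (smul_eq_zero.1 h0).resolve_left hε.ne'
  have hle : ∀ n : ℕ, (n : ℝ) • ((x - s) ⊓ w) ≤ w := by
    intro n
    obtain rfl | hn := Nat.eq_zero_or_pos n
    · simpa using hw.1
    have hε : (0 : ℝ) < (n : ℝ)⁻¹ := by positivity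
    -- A zero level component means that the band of `g` contains `w`; then `f`, disjoint from `g`,
    -- is disjoint from `w` and vanishes.
    have h1 : x - s ≤ (n : ℝ)⁻¹ • w := by
      have hl := isLUB_levelComponent w (x - s) (n : ℝ)⁻¹
      rw [key _ hε, sub_zero] at hl
      set g := ((n : ℝ)⁻¹ • w - (x - s))⁺
      set f := ((x - s) - (n : ℝ)⁻¹ • w)⁺
      have hfg : f ⊓ g = 0 := by
        have := posPart_inf_negPart_eq_zero ((x - s) - (n : ℝ)⁻¹ • w)
        rwa [← posPart_neg, neg_sub] at this
      have : w ⊓ f ≤ 0 := by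
        refine inf_le_of_isLUB hl ?_
        rintro _ ⟨m, rfl⟩
        rw [inf_comm]
        exact (inf_le_inf_left _ inf_le_right).trans (inf_smul_eq_zero hfg m.cast_nonneg).le
      have hf0 := hw.2 f (by
        rw [abs_of_nonneg (posPart_nonneg _)]
        exact le_antisymm this (le_inf hw.1 (posPart_nonneg _)))
      exact sub_nonpos.1 (posPart_eq_zero.1 hf0)
    have h2 := smul_le_smul_of_nonneg_left (inf_le_left.trans h1 : (x - s) ⊓ w ≤ _)
      (n.cast_nonneg (α := ℝ))
    rwa [smul_smul, mul_inv_cancel₀ (by positivity), one_smul] at h2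
  have h0 : (x - s) ⊓ w = 0 :=
    le_antisymm (nonpos_of_forall_natCast_smul_le hle) (le_inf hd hw.1)
  have := hw.2 (x - s) (by rwa [abs_of_nonneg hd, inf_comm])
  exact (sub_eq_zero.1 this).le

end Components

end Module

/-! ### The embedding into the universal completion. -/

section Completion

variable {E : Type*} [AddCommGroup E] [ConditionallyCompleteLattice E] [IsOrderedAddMonoid E]
  [Module ℝ E] [IsOrderedModule ℝ E]
variable {U : Type*} [AddCommGroup U] [ConditionallyCompleteLattice U] [IsOrderedAddMonoid U]
  [Module ℝ U] [IsOrderedModule ℝ U]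
variable {i : E →ₗ[ℝ] U}

namespace IsUniversalCompletion

lemma map_le_map_iff (hU : IsUniversalCompletion i) {x y : E} : i x ≤ i y ↔ x ≤ y := by
  rw [← sup_eq_right, ← hU.map_sup, hU.injective.eq_iff, sup_eq_right]

lemma monotone (hU : IsUniversalCompletion i) : Monotone i := fun _ _ => hU.map_le_map_iff.2

lemma map_nonneg_iff (hU : IsUniversalCompletion i) {x : E} : 0 ≤ i x ↔ 0 ≤ x := by
  rw [← map_zero i, hU.map_le_map_iff]

lemma map_inf (hU : IsUniversalCompletion i) (x y : E) : i (x ⊓ y) = i x ⊓ i y := by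
  have h1 := congrArg i (inf_add_sup x y)
  rw [map_add, map_add, hU.map_sup, ← inf_add_sup (i x)] at h1
  exact add_right_cancel h1

lemma isLUB_of_isLUB_map (hU : IsUniversalCompletion i) {A : Set E} {s : E}
    (h : IsLUB (i '' A) (i s)) : IsLUB A s :=
  ⟨fun a ha => hU.map_le_map_iff.1 (h.1 ⟨a, ha, rfl⟩), fun b hb => hU.map_le_map_iff.1
    (h.2 (by rintro _ ⟨a, ha, rfl⟩; exact hU.monotone (hb ha)))⟩

/-- A gap `(i s - u)⁺ > 0` would contain some `i z > 0` by order density, making `s - z` an upper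
bound of `A`. -/
lemma isLUB_map (hU : IsUniversalCompletion i) {A : Set E} {s : E} (h : IsLUB A s) :
    IsLUB (i '' A) (i s) := by
  refine ⟨by rintro _ ⟨a, ha, rfl⟩; exact hU.monotone (h.1 ha), fun u hu => ?_⟩
  by_contra hsu
  obtain ⟨z, hz, hzu⟩ := hU.orderDense _ (posPart_sub_pos_of_not_le hsu)
  rw [← sub_inf_eq_posPart_sub] at hzu
  have : s ≤ s - z := h.2 fun a ha => by
    rw [← hU.map_le_map_iff, map_sub]
    exact le_of_sub_eq
      (add_le_add (le_inf (hU.monotone (h.1 ha)) (hu ⟨a, ha, rfl⟩)) hzu) (by abel)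
  exact absurd hz (not_lt_of_ge (le_of_sub_eq this (by abel)))

/-- Every positive element of the completion is the supremum of the positive elements of the
original space below it. -/
lemma isLUB_below (hU : IsUniversalCompletion i) {x : U} (hx : 0 ≤ x) :
    IsLUB (i '' {y | 0 ≤ y ∧ i y ≤ x}) x := by
  refine ⟨by rintro _ ⟨a, ha, rfl⟩; exact ha.2, fun u hu => ?_⟩
  by_contra hsu
  obtain ⟨z, hz, hzu⟩ := hU.orderDense _ (posPart_sub_pos_of_not_le hsu)
  rw [← sub_inf_eq_posPart_sub] at hzu
  -- Elements of `E` below `x` are also below `u`, so adding `i z ≤ x - x ⊓ u` stays below `x`, and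
  -- this can be iterated.
  have hn : ∀ n : ℕ, i ((n : ℝ) • z) ≤ x := by
    intro n
    induction n with
    | zero => simpa using hx
    | succ n ih =>
      have h0 : 0 ≤ (n : ℝ) • z := smul_nonneg n.cast_nonneg hz.le
      have := add_le_add (le_inf ih (hu ⟨_, ⟨h0, ih⟩, rfl⟩)) hzu
      refine le_of_sub_eq this ?_
      push_cast
      rw [add_smul, one_smul, map_add]
      abel
  have := nonpos_of_forall_natCast_smul_le (x := i z) (y := x) fun n => by
    rw [← map_smul]; exact hn n
  rw [← map_zero i, hU.map_le_map_iff] at this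
  exact absurd hz (not_lt_of_ge this)

/-- The original space is an ideal of the completion. -/
lemma exists_map_eq (hU : IsUniversalCompletion i) {u : U} {y : E} (hu : 0 ≤ u) (h : u ≤ i y) :
    ∃ z, 0 ≤ z ∧ i z = u := by
  have hb : BddAbove {z | 0 ≤ z ∧ i z ≤ u} :=
    ⟨y, fun z hz => hU.map_le_map_iff.1 (hz.2.trans h)⟩
  -- The supremum taken in `E` maps to `u` because `i` preserves suprema.
  have hl := isLUB_csSup (s := {z | 0 ≤ z ∧ i z ≤ u}) ⟨0, le_rfl, by simpa using hu⟩ hb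
  have := (hU.isLUB_map hl).unique (hU.isLUB_below hu)
  exact ⟨_, hU.map_nonneg_iff.1 (hu.trans_eq this.symm), this⟩

lemma isWeakOrderUnit_map (hU : IsUniversalCompletion i) {e : E} (he : IsWeakOrderUnit e) :
    IsWeakOrderUnit (i e) := by
  refine ⟨hU.map_nonneg_iff.2 he.1, fun x hx => ?_⟩
  by_contra hne
  have hpos : 0 < |x| := lt_of_le_of_ne (abs_nonneg x) fun h => hne (by
    have h1 := le_abs_self x
    have h2 := neg_le_abs x
    rw [← h] at h1 h2
    exact le_antisymm h1 (neg_nonpos.1 h2))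
  obtain ⟨z, hz, hzx⟩ := hU.orderDense _ hpos
  have h0 : e ⊓ |z| = 0 := by
    apply hU.injective
    rw [abs_of_nonneg hz.le, hU.map_inf, map_zero]
    exact inf_eq_zero_mono hx (hU.map_nonneg_iff.2 he.1) (hU.map_nonneg_iff.2 hz.le) le_rfl hzx
  exact hz.ne' (he.2 z h0)

end IsUniversalCompletion

namespace IsOrderContinuous

/-- Positivity is already contained in order continuity, applied to the directed set `{x, 0}`. -/
lemma map_nonneg {R : E →ₗ[ℝ] E} (hR : IsOrderContinuous R) {x : E} (hx : 0 ≤ x) : 0 ≤ R x := by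
  have := hR {x, 0} (Set.insert_nonempty _ _)
    (by
      rintro a (rfl | rfl) b (rfl | rfl)
      · exact ⟨_, Set.mem_insert _ _, le_rfl, le_rfl⟩
      · exact ⟨0, by simp, hx, le_rfl⟩
      · exact ⟨0, by simp, le_rfl, hx⟩
      · exact ⟨0, by simp, le_rfl, le_rfl⟩)
    ⟨by rintro _ (rfl | rfl); exacts [hx, le_rfl], fun b hb => hb (by simp)⟩
  exact this.1 ⟨x, by simp, rfl⟩

lemma monotone {R : E →ₗ[ℝ] E} (hR : IsOrderContinuous R) : Monotone R := fun x y h => by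
  have := hR.map_nonneg (sub_nonneg.2 h)
  rwa [map_sub, sub_nonneg] at this

lemma isLUB_map {R : E →ₗ[ℝ] E} (hR : IsOrderContinuous R) {A : Set E} {s : E}
    (hne : A.Nonempty) (hd : DirectedOn (· ≤ ·) A) (h : IsLUB A s) : IsLUB (R '' A) (R s) := by
  have hg := hR ((fun a => s - a) '' A) (hne.image _)
    (by
      rintro _ ⟨a, ha, rfl⟩ _ ⟨b, hb, rfl⟩
      obtain ⟨c, hc, hac, hbc⟩ := hd a ha b hb
      exact ⟨s - c, ⟨c, hc, rfl⟩, sub_le_sub_left hac s, sub_le_sub_left hbc s⟩)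
    ⟨by rintro _ ⟨a, ha, rfl⟩; exact sub_nonneg.2 (h.1 ha), fun b hb => by
      have : s ≤ s - b := h.2 fun a ha => le_sub_comm.1 (hb ⟨a, ha, rfl⟩)
      exact le_of_sub_eq this (by abel)⟩
  refine ⟨by rintro _ ⟨a, ha, rfl⟩; exact hR.monotone (h.1 ha), fun b hb => ?_⟩
  have : R s - b ≤ 0 := hg.2 (by
    rintro _ ⟨_, ⟨a, ha, rfl⟩, rfl⟩
    rw [map_sub]
    exact sub_le_sub_left (hb ⟨a, ha, rfl⟩) _)
  exact sub_nonpos.1 this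

end IsOrderContinuous

/-! ### Extension of order continuous operators to the completion. -/

/-- The extension of `R` to the positive element `x` of the completion is defined, with value
`v`. -/
def IsPosExtension (i : E →ₗ[ℝ] U) (R : E →ₗ[ℝ] E) (x v : U) : Prop :=
  0 ≤ x ∧ IsLUB (imagesBelow i R x) v

/-- Independence of the net: for `i y ≤ x` the elements `a ⊓ y` increase to `y`, so `R y` is the
supremum of the `R (a ⊓ y) ≤ R a`. Upper bounds are compared so as to serve both boundedness and
suprema. -/
lemma upperBounds_imagesBelow (hU : IsUniversalCompletion i) {R : E →ₗ[ℝ] E}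
    (hR : IsOrderContinuous R) {A : Set E} {x : U} (hne : A.Nonempty)
    (hd : DirectedOn (· ≤ ·) A) (h0 : ∀ a ∈ A, 0 ≤ a) (h : IsLUB (i '' A) x) :
    upperBounds (imagesBelow i R x) = upperBounds ((fun a => i (R a)) '' A) := by
  ext c
  constructor
  · rintro hc _ ⟨a, ha, rfl⟩
    exact hc ⟨a, h0 a ha, h.1 ⟨a, ha, rfl⟩, rfl⟩
  · rintro hc _ ⟨y, hy, hyx, rfl⟩
    have h1 : IsLUB ((fun a => a ⊓ y) '' A) y := by
      apply hU.isLUB_of_isLUB_map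
      have := isLUB_image_inf h (i y)
      rw [inf_eq_right.2 hyx] at this
      convert this using 1
      simp only [Set.image_image, hU.map_inf]
    have h2 := hU.isLUB_map (hR.isLUB_map (hne.image _) (by
      rintro _ ⟨a, ha, rfl⟩ _ ⟨b, hb, rfl⟩
      obtain ⟨c, hc, hac, hbc⟩ := hd a ha b hb
      exact ⟨_, ⟨c, hc, rfl⟩, inf_le_inf_right y hac, inf_le_inf_right y hbc⟩) h1)
    refine h2.2 ?_
    rintro _ ⟨_, ⟨_, ⟨a, ha, rfl⟩, rfl⟩, rfl⟩
    exact (hU.monotone (hR.monotone inf_le_left)).trans (hc ⟨a, ha, rfl⟩)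

lemma directedOn_below (hU : IsUniversalCompletion i) (x : U) :
    DirectedOn (· ≤ ·) {y : E | 0 ≤ y ∧ i y ≤ x} := by
  rintro a ⟨ha, hax⟩ b ⟨hb, hbx⟩
  exact ⟨a ⊔ b, ⟨ha.trans le_sup_left, by rw [hU.map_sup]; exact sup_le hax hbx⟩,
    le_sup_left, le_sup_right⟩

lemma below_nonempty {x : U} (hx : 0 ≤ x) : {y : E | 0 ≤ y ∧ i y ≤ x}.Nonempty :=
  ⟨0, le_rfl, by simpa using hx⟩

lemma imagesBelow_eq (i : E →ₗ[ℝ] U) (R : E →ₗ[ℝ] E) (x : U) :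
    imagesBelow i R x = (fun a => i (R a)) '' {y | 0 ≤ y ∧ i y ≤ x} := by
  ext v
  constructor
  · rintro ⟨y, hy, hyx, rfl⟩
    exact ⟨y, ⟨hy, hyx⟩, rfl⟩
  · rintro ⟨y, ⟨hy, hyx⟩, rfl⟩
    exact ⟨y, hy, hyx, rfl⟩

lemma exists_isPosExtension {R : E →ₗ[ℝ] E} {x : U} (hx : 0 ≤ x)
    (h : BddAbove (imagesBelow i R x)) : ∃ v, IsPosExtension i R x v :=
  ⟨_, hx, isLUB_csSup ⟨_, 0, le_rfl, by simpa using hx, rfl⟩ h⟩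

namespace IsPosExtension

variable {R : E →ₗ[ℝ] E} {x y v w : U}

lemma unique (h : IsPosExtension i R x v) (h' : IsPosExtension i R x w) : v = w :=
  h.2.unique h'.2

lemma sSup_eq (h : IsPosExtension i R x v) : sSup (imagesBelow i R x) = v :=
  h.2.csSup_eq ⟨_, 0, le_rfl, by simpa using h.1, rfl⟩

lemma nonneg (h : IsPosExtension i R x v) : 0 ≤ v :=
  h.2.1 ⟨0, le_rfl, by simpa using h.1, by simp⟩

lemma of_net (hU : IsUniversalCompletion i) (hR : IsOrderContinuous R) {A : Set E}
    (hne : A.Nonempty) (hd : DirectedOn (· ≤ ·) A) (h0 : ∀ a ∈ A, 0 ≤ a)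
    (h : IsLUB (i '' A) x) (hv : IsLUB ((fun a => i (R a)) '' A) v) :
    IsPosExtension i R x v := by
  refine ⟨?_, ?_⟩
  · obtain ⟨a, ha⟩ := hne
    exact (hU.map_nonneg_iff.2 (h0 a ha)).trans (h.1 ⟨a, ha, rfl⟩)
  · rwa [IsLUB, upperBounds_imagesBelow hU hR hne hd h0 h]

lemma map (hU : IsUniversalCompletion i) (hR : IsOrderContinuous R) {y : E} (hy : 0 ≤ y) :
    IsPosExtension i R (i y) (i (R y)) :=
  of_net hU hR (Set.singleton_nonempty y) (directedOn_singleton y) (by simpa using hy)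
    (by simp) (by simp)

lemma zero (hU : IsUniversalCompletion i) (hR : IsOrderContinuous R) :
    IsPosExtension i R 0 0 := by
  simpa using map hU hR (le_refl (0 : E))

lemma mono (h : IsPosExtension i R x v) (h' : IsPosExtension i R y w) (hxy : x ≤ y) : v ≤ w :=
  h.2.2 (by rintro _ ⟨a, ha, hax, rfl⟩; exact h'.2.1 ⟨a, ha, hax.trans hxy, rfl⟩)

lemma exists_of_le (h : IsPosExtension i R y w) (hx : 0 ≤ x) (hxy : x ≤ y) :
    ∃ v, IsPosExtension i R x v :=
  exists_isPosExtension hx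
    ⟨w, by rintro _ ⟨a, ha, hax, rfl⟩; exact h.2.1 ⟨a, ha, hax.trans hxy, rfl⟩⟩

lemma isLUB_image (h : IsPosExtension i R x v) :
    IsLUB ((fun a => i (R a)) '' {y | 0 ≤ y ∧ i y ≤ x}) v := by
  rw [← imagesBelow_eq]
  exact h.2

lemma add (hU : IsUniversalCompletion i) (hR : IsOrderContinuous R)
    (h : IsPosExtension i R x v) (h' : IsPosExtension i R y w) :
    IsPosExtension i R (x + y) (v + w) := by
  refine of_net hU hR (A := Set.image2 (· + ·) {a | 0 ≤ a ∧ i a ≤ x} {a | 0 ≤ a ∧ i a ≤ y})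
    ((below_nonempty h.1).image2 (below_nonempty h'.1)) ?_ ?_ ?_ ?_
  · rintro _ ⟨a, ha, b, hb, rfl⟩ _ ⟨a', ha', b', hb', rfl⟩
    obtain ⟨c, hc, hac, hac'⟩ := directedOn_below hU x a ha a' ha'
    obtain ⟨d, hd, hbd, hbd'⟩ := directedOn_below hU y b hb b' hb'
    exact ⟨_, ⟨c, hc, d, hd, rfl⟩, add_le_add hac hbd, add_le_add hac' hbd'⟩
  · rintro _ ⟨a, ha, b, hb, rfl⟩
    exact add_nonneg ha.1 hb.1
  · convert (hU.isLUB_below h.1).add (hU.isLUB_below h'.1) using 1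
    simp only [Set.image_image2, map_add, ← Set.image2_add, Set.image2_image_left,
      Set.image2_image_right]
  · convert h.isLUB_image.add h'.isLUB_image using 1
    simp only [Set.image_image2, map_add, ← Set.image2_add, Set.image2_image_left,
      Set.image2_image_right]

lemma sub (hU : IsUniversalCompletion i) (hR : IsOrderContinuous R)
    (h : IsPosExtension i R x v) (h' : IsPosExtension i R y w) (hyx : y ≤ x) :
    IsPosExtension i R (x - y) (v - w) := by
  obtain ⟨z, hz⟩ := h.exists_of_le (sub_nonneg.2 hyx) (sub_le_self x h'.1)
  have := hz.add hU hR h'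
  rw [sub_add_cancel] at this
  rw [h.unique this, add_sub_cancel_right]
  exact hz

lemma extend_eq (hU : IsUniversalCompletion i) (hR : IsOrderContinuous R)
    (h : IsPosExtension i R x v) : extend i R x = v := by
  rw [extend, posPart_of_nonneg h.1, negPart_of_nonneg h.1, h.sSup_eq, (zero hU hR).sSup_eq,
    sub_zero]

lemma extend_sub_eq (h : IsPosExtension i R x⁺ v) (h' : IsPosExtension i R x⁻ w) :
    extend i R x = v - w := by
  rw [extend, h.sSup_eq, h'.sSup_eq]

lemma sup (hU : IsUniversalCompletion i) (hR : IsOrderContinuous R)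
    (hsup : ∀ a b, R (a ⊔ b) = R a ⊔ R b)
    (h : IsPosExtension i R x v) (h' : IsPosExtension i R y w) :
    IsPosExtension i R (x ⊔ y) (v ⊔ w) := by
  -- Used for `f = i` and for `f = i ∘ R`.
  have key : ∀ {f : E → U} (_ : ∀ a b, f (a ⊔ b) = f a ⊔ f b) {x' y' : U}
      (_ : IsLUB (f '' {a | 0 ≤ a ∧ i a ≤ x}) x') (_ : IsLUB (f '' {a | 0 ≤ a ∧ i a ≤ y}) y'),
      IsLUB (f '' (Set.image2 (· ⊔ ·) {a | 0 ≤ a ∧ i a ≤ x} {a | 0 ≤ a ∧ i a ≤ y}))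
        (x' ⊔ y') := by
    intro f hf x' y' hx' hy'
    refine ⟨?_, fun c hc => sup_le (hx'.2 ?_) (hy'.2 ?_)⟩
    · rintro _ ⟨_, ⟨a, ha, b, hb, rfl⟩, rfl⟩
      rw [hf]
      exact sup_le_sup (hx'.1 ⟨a, ha, rfl⟩) (hy'.1 ⟨b, hb, rfl⟩)
    · rintro _ ⟨a, ha, rfl⟩
      obtain ⟨b, hb⟩ := below_nonempty (i := i) h'.1
      have := hc ⟨_, ⟨a, ha, b, hb, rfl⟩, rfl⟩
      rw [hf] at this
      exact le_sup_left.trans this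
    · rintro _ ⟨b, hb, rfl⟩
      obtain ⟨a, ha⟩ := below_nonempty (i := i) h.1
      have := hc ⟨_, ⟨a, ha, b, hb, rfl⟩, rfl⟩
      rw [hf] at this
      exact le_sup_right.trans this
  refine of_net hU hR (A := Set.image2 (· ⊔ ·) {a | 0 ≤ a ∧ i a ≤ x} {a | 0 ≤ a ∧ i a ≤ y})
    ((below_nonempty h.1).image2 (below_nonempty h'.1)) ?_ ?_
    (key hU.map_sup (hU.isLUB_below h.1) (hU.isLUB_below h'.1))
    (key (fun a b => by rw [hsup, hU.map_sup]) h.isLUB_image h'.isLUB_image)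
  · rintro _ ⟨a, ha, b, hb, rfl⟩ _ ⟨a', ha', b', hb', rfl⟩
    obtain ⟨c, hc, hac, hac'⟩ := directedOn_below hU x a ha a' ha'
    obtain ⟨d, hd, hbd, hbd'⟩ := directedOn_below hU y b hb b' hb'
    exact ⟨_, ⟨c, hc, d, hd, rfl⟩, sup_le_sup hac hbd, sup_le_sup hac' hbd'⟩
  · rintro _ ⟨a, ha, b, hb, rfl⟩
    exact ha.1.trans le_sup_left

/-- Disjointness means `x + y = x ⊔ y`, which the extension carries to `v + w = v ⊔ w`. -/
lemma inf_eq_zero (hU : IsUniversalCompletion i) (hR : IsOrderContinuous R)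
    (hsup : ∀ a b, R (a ⊔ b) = R a ⊔ R b)
    (h : IsPosExtension i R x v) (h' : IsPosExtension i R y w) (hxy : x ⊓ y = 0) :
    v ⊓ w = 0 := by
  have h1 := (h.sup hU hR hsup h').unique
    (by rw [← add_eq_sup_of_disjoint hxy]; exact h.add hU hR h')
  have h2 := inf_add_sup v w
  rw [h1] at h2
  exact add_eq_right.1 h2

end IsPosExtension

lemma mem_domCone_iff (hU : IsUniversalCompletion i) {T : E →ₗ[ℝ] E} (hT : IsOrderContinuous T)
    {x : U} : x ∈ domCone i T ↔ ∃ v, IsPosExtension i T x v := by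
  constructor
  · rintro ⟨hx, A, hne, hd, h0, hl, hb⟩
    refine exists_isPosExtension hx ?_
    rwa [BddAbove, upperBounds_imagesBelow hU hT hne hd h0 hl]
  · rintro ⟨v, hv⟩
    exact ⟨hv.1, _, below_nonempty hv.1, directedOn_below hU x, fun a ha => ha.1,
      hU.isLUB_below hv.1, v, hv.isLUB_image.1⟩

lemma exists_isPosExtension_of_mem_L1 (hU : IsUniversalCompletion i) {T : E →ₗ[ℝ] E}
    (hT : IsOrderContinuous T) {x : U} (h : x ∈ L1 i T) :
    (∃ v, IsPosExtension i T x⁺ v) ∧ ∃ v, IsPosExtension i T x⁻ v := by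
  obtain ⟨a, ha, b, hb, rfl⟩ := h
  obtain ⟨v, hv⟩ := (mem_domCone_iff hU hT).1 ha
  obtain ⟨w, hw⟩ := (mem_domCone_iff hU hT).1 hb
  refine ⟨hv.exists_of_le (posPart_nonneg _) (posPart_le_of_le (sub_le_self _ hw.1) hv.1),
    hw.exists_of_le (negPart_nonneg _) ?_⟩
  rw [← posPart_neg, neg_sub]
  exact posPart_le_of_le (sub_le_self _ hv.1) hw.1

lemma exists_isPosExtension_abs_of_mem_L1 (hU : IsUniversalCompletion i) {T : E →ₗ[ℝ] E}
    (hT : IsOrderContinuous T) {x : U} (h : x ∈ L1 i T) : ∃ v, IsPosExtension i T |x| v := by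
  obtain ⟨⟨v, hv⟩, w, hw⟩ := exists_isPosExtension_of_mem_L1 hU hT h
  rw [← posPart_add_negPart]
  exact ⟨_, hv.add hU hT hw⟩

lemma IsPosExtension.mem_L1 (hU : IsUniversalCompletion i) {T : E →ₗ[ℝ] E}
    (hT : IsOrderContinuous T) {x v : U} (h : IsPosExtension i T x v) : x ∈ L1 i T :=
  ⟨x, (mem_domCone_iff hU hT).2 ⟨v, h⟩, 0,
    (mem_domCone_iff hU hT).2 ⟨0, IsPosExtension.zero hU hT⟩, (sub_zero x).symm⟩

end Completion

/-! ### Elements fixed by the conditional expectation, and their powers. -/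

section Expectation

variable {E : Type*} [AddCommGroup E] [ConditionallyCompleteLattice E] [IsOrderedAddMonoid E]
  [Module ℝ E] [IsOrderedModule ℝ E]
variable {U : Type*} [AddCommGroup U] [ConditionallyCompleteLattice U] [IsOrderedAddMonoid U]
  [Module ℝ U] [IsOrderedModule ℝ U]
variable {i : E →ₗ[ℝ] U} {e : E} {T S : E →ₗ[ℝ] E}

/-- Makes a set directed, hence usable as a net, without changing suprema. -/
lemma isLUB_image_supClosure {f : E → U} (hf : ∀ a b, f (a ⊔ b) = f a ⊔ f b) {A : Set E} {x : U} :
    IsLUB (f '' supClosure A) x ↔ IsLUB (f '' A) x := by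
  have : upperBounds (f '' supClosure A) = upperBounds (f '' A) := by
    refine Set.Subset.antisymm (upperBounds_mono_set (Set.image_mono subset_supClosure)) ?_
    rintro b hb _ ⟨a, ha, rfl⟩
    exact supClosure_min (t := {a | f a ≤ b}) (fun a ha => hb ⟨a, ha, rfl⟩)
      (fun a ha c hc => (hf a c).trans_le (sup_le ha hc)) ha
  rw [IsLUB, IsLUB, this]

lemma isComponent_zero {w : U} (hw : 0 ≤ w) : IsComponent w 0 := by
  rw [IsComponent, sub_zero, inf_eq_left.2 hw]

lemma zero_mem_stepPowers {w : U} (hw : 0 ≤ w) {x : U} (hx : 0 ≤ x) (q : ℝ) :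
    (0 : U) ∈ stepPowers w q x :=
  ⟨0, 0, le_rfl, isComponent_zero hw, by simpa using hx, by simp⟩

lemma isLUB_power {w : U} (hw : 0 ≤ w) {x : U} (hx : 0 ≤ x) {q : ℝ}
    (h : BddAbove (stepPowers w q x)) : IsLUB (stepPowers w q x) (power w q x) :=
  isLUB_csSup ⟨0, zero_mem_stepPowers hw hx q⟩ h

namespace IsConditionalRieszTriple

lemma eq_zero_of_map_eq_zero (hT : IsConditionalRieszTriple e T) {x : E} (hx : 0 ≤ x)
    (h : T x = 0) : x = 0 := by
  by_contra hne
  exact (hT.strictlyPositive x (lt_of_le_of_ne hx (Ne.symm hne))).ne' h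

lemma eq_zero_of_isPosExtension_zero (hU : IsUniversalCompletion i)
    (hT : IsConditionalRieszTriple e T) {x : U} (h : IsPosExtension i T x 0) : x = 0 := by
  by_contra hne
  obtain ⟨z, hz, hzx⟩ := hU.orderDense x (lt_of_le_of_ne h.1 (Ne.symm hne))
  have := (IsPosExtension.map hU hT.orderContinuous hz.le).mono h hzx
  rw [← map_zero i, hU.map_le_map_iff] at this
  exact absurd (hT.strictlyPositive z hz) (not_lt_of_ge this)

lemma isPosExtension_idem (hU : IsUniversalCompletion i) (hT : IsConditionalRieszTriple e T)
    {x v : U} (h : IsPosExtension i T x v) : IsPosExtension i T v v := by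
  have hO := hT.orderContinuous
  refine .of_net hU hO (A := T '' {y | 0 ≤ y ∧ i y ≤ x}) ((below_nonempty h.1).image _) ?_ ?_ ?_ ?_
  · rintro _ ⟨a, ha, rfl⟩ _ ⟨b, hb, rfl⟩
    obtain ⟨c, hc, hac, hbc⟩ := directedOn_below hU x a ha b hb
    exact ⟨_, ⟨c, hc, rfl⟩, hO.monotone hac, hO.monotone hbc⟩
  · rintro _ ⟨a, ha, rfl⟩
    exact hO.map_nonneg ha.1
  · rw [Set.image_image]
    exact h.isLUB_image
  · rw [Set.image_image]
    simpa only [hT.projection] using h.isLUB_image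

/-- `T (v - x) = v - v = 0` by idempotence, and strict positivity gives `v = x`. -/
lemma fixed_of_le (hU : IsUniversalCompletion i) (hT : IsConditionalRieszTriple e T)
    {x v : U} (h : IsPosExtension i T x v) (hle : x ≤ v) : x = v := by
  have := (hT.isPosExtension_idem hU h).sub hU hT.orderContinuous h hle
  rw [sub_self] at this
  exact (sub_eq_zero.1 (hT.eq_zero_of_isPosExtension_zero hU this)).symm

lemma fixed_of_ge (hU : IsUniversalCompletion i) (hT : IsConditionalRieszTriple e T)
    {x v : U} (h : IsPosExtension i T x v) (hle : v ≤ x) : x = v := by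
  have := h.sub hU hT.orderContinuous (hT.isPosExtension_idem hU h) hle
  rw [sub_self] at this
  exact sub_eq_zero.1 (hT.eq_zero_of_isPosExtension_zero hU this)

lemma fixed_sup (hU : IsUniversalCompletion i) (hT : IsConditionalRieszTriple e T)
    {a b : U} (ha : IsPosExtension i T a a) (hb : IsPosExtension i T b b) :
    IsPosExtension i T (a ⊔ b) (a ⊔ b) := by
  obtain ⟨s, hs⟩ := (ha.add hU hT.orderContinuous hb).exists_of_le (ha.1.trans le_sup_left)
    (sup_le (le_add_of_nonneg_right hb.1) (le_add_of_nonneg_left ha.1))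
  have := hT.fixed_of_le hU hs (sup_le (ha.mono hs le_sup_left) (hb.mono hs le_sup_right))
  rwa [← this] at hs

/-- `T m ≤ T a = a` for every `a ∈ A`, so `T m ≤ m`, and `fixed_of_ge` applies. -/
lemma fixed_of_isGLB (hU : IsUniversalCompletion i) (hT : IsConditionalRieszTriple e T)
    {A : Set U} {m : U} (hne : A.Nonempty) (hA : ∀ a ∈ A, IsPosExtension i T a a)
    (hm : IsGLB A m) : IsPosExtension i T m m := by
  obtain ⟨a, ha⟩ := hne
  obtain ⟨s, hs⟩ := (hA a ha).exists_of_le (hm.2 fun b hb => (hA b hb).1) (hm.1 ha)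
  have := hT.fixed_of_ge hU hs (hm.2 fun b hb => hs.mono (hA b hb) (hm.1 hb))
  rwa [← this] at hs

lemma fixed_inf (hU : IsUniversalCompletion i) (hT : IsConditionalRieszTriple e T)
    {a b : U} (ha : IsPosExtension i T a a) (hb : IsPosExtension i T b b) :
    IsPosExtension i T (a ⊓ b) (a ⊓ b) :=
  hT.fixed_of_isGLB hU (Set.insert_nonempty a {b}) (by rintro _ (rfl | rfl); exacts [ha, hb])
    isGLB_pair

lemma fixed_posPart_sub (hU : IsUniversalCompletion i) (hT : IsConditionalRieszTriple e T)
    {a b : U} (ha : IsPosExtension i T a a) (hb : IsPosExtension i T b b) :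
    IsPosExtension i T (a - b)⁺ (a - b)⁺ := by
  have : (a - b)⁺ = a ⊔ b - b := by rw [posPart_def, sup_sub, sub_self]
  rw [this]
  exact (hT.fixed_sup hU ha hb).sub hU hT.orderContinuous hb le_sup_right

lemma fixed_smul_unit (hU : IsUniversalCompletion i) (hT : IsConditionalRieszTriple e T)
    {t : ℝ} (ht : 0 ≤ t) : IsPosExtension i T (t • i e) (t • i e) := by
  have := IsPosExtension.map hU hT.orderContinuous (smul_nonneg ht hT.weakUnit.1)
  rwa [map_smul, map_smul, map_smul, hT.map_unit] at this

lemma fixed_unit (hU : IsUniversalCompletion i) (hT : IsConditionalRieszTriple e T) :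
    IsPosExtension i T (i e) (i e) := by
  simpa using hT.fixed_smul_unit hU zero_le_one

lemma fixed_natCast_smul (hU : IsUniversalCompletion i) (hT : IsConditionalRieszTriple e T)
    {a : U} (ha : IsPosExtension i T a a) (n : ℕ) :
    IsPosExtension i T ((n : ℝ) • a) ((n : ℝ) • a) := by
  induction n with
  | zero => simpa using IsPosExtension.zero hU hT.orderContinuous
  | succ n ih =>
    push_cast
    rw [add_smul, one_smul]
    exact ih.add hU hT.orderContinuous ha

lemma fixed_levelComponent (hU : IsUniversalCompletion i) (hT : IsConditionalRieszTriple e T)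
    {x : U} (hx : IsPosExtension i T x x) {t : ℝ} (ht : 0 ≤ t) :
    IsPosExtension i T (levelComponent (i e) x t) (levelComponent (i e) x t) := by
  have hl := isLUB_levelComponent (i e) x t
  refine hT.fixed_of_isGLB hU
    (A := Set.range fun n : ℕ => i e - i e ⊓ (n : ℝ) • (t • i e - x)⁺) ⟨_, 0, rfl⟩ ?_ ⟨?_, ?_⟩
  · rintro _ ⟨n, rfl⟩
    exact (hT.fixed_unit hU).sub hU hT.orderContinuous (hT.fixed_inf hU (hT.fixed_unit hU)
      (hT.fixed_natCast_smul hU (hT.fixed_posPart_sub hU (hT.fixed_smul_unit hU ht) hx) n))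
      inf_le_left
  · rintro _ ⟨n, rfl⟩
    exact le_sub_comm.1 (hl.1 ⟨n, rfl⟩)
  · intro b hb
    have := hl.2 (show i e - b ∈ upperBounds _ by
      rintro _ ⟨n, rfl⟩
      exact le_sub_comm.1 (hb ⟨n, rfl⟩))
    exact (sub_le_sub_iff_left _).1 this

lemma map_eq_of_fixed (hU : IsUniversalCompletion i) (hT : IsConditionalRieszTriple e T)
    {f : E} (h : IsPosExtension i T (i f) (i f)) : T f = f :=
  hU.injective ((IsPosExtension.map hU hT.orderContinuous (hU.map_nonneg_iff.1 h.1)).unique h)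

/-- The level components of a `T`-fixed element come from `T`-fixed elements of `E`. -/
lemma exists_map_eq_levelComponent (hU : IsUniversalCompletion i)
    (hT : IsConditionalRieszTriple e T) {x : U} (hx : IsPosExtension i T x x) {t : ℝ}
    (ht : 0 ≤ t) : ∃ c, 0 ≤ c ∧ i c = levelComponent (i e) x t ∧ T c = c := by
  obtain ⟨c, hc0, hc⟩ := hU.exists_map_eq (levelComponent_nonneg (i e) x t)
    (levelComponent_le (hU.map_nonneg_iff.2 hT.weakUnit.1) x t)
  exact ⟨c, hc0, hc, hT.map_eq_of_fixed hU (by rw [hc]; exact hT.fixed_levelComponent hU hx ht)⟩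

/-- Powers with exponent at most one of `T`-fixed elements are `T`-fixed. -/
lemma fixed_power (hU : IsUniversalCompletion i) (hT : IsConditionalRieszTriple e T)
    {x : U} (hx : IsPosExtension i T x x) {r : ℝ} (hr0 : 0 ≤ r) (hr1 : r ≤ 1) :
    IsPosExtension i T (power (i e) r x) (power (i e) r x) := by
  have hw : 0 ≤ i e := hU.map_nonneg_iff.2 hT.weakUnit.1
  have hbdd : BddAbove (stepPowers (i e) r x) := by
    -- From `t ^ r ≤ 1 + t` for `0 ≤ r ≤ 1`; this is where the exponent is restricted.
    refine ⟨i e + x, ?_⟩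
    rintro _ ⟨t, p, ht, hp, hpx, rfl⟩
    have htr : t ^ r ≤ 1 + t := by
      obtain h | h := le_total t 1
      · exact (Real.rpow_le_one ht h hr0).trans (by linarith)
      · exact (Real.rpow_le_rpow_of_exponent_le h hr1).trans (by rw [Real.rpow_one]; linarith)
    refine (smul_le_smul_of_nonneg_right htr hp.nonneg).trans ?_
    rw [add_smul, one_smul]
    exact add_le_add hp.le hpx
  have hl := isLUB_power hw hx.1 hbdd
  set A : Set E := {f | (0 ≤ f ∧ T f = f) ∧ i f ∈ stepPowers (i e) r x}
  have hlA : IsLUB (i '' A) (power (i e) r x) := by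
    -- Fixed step elements suffice: each admissible component is dominated by the level component at
    -- the same `t`, which is fixed.
    refine ⟨by rintro _ ⟨a, ha, rfl⟩; exact hl.1 ha.2, fun b hb => hl.2 ?_⟩
    rintro _ ⟨t, p, ht, hp, hpx, rfl⟩
    obtain ⟨c, hc0, hc, hTc⟩ := hT.exists_map_eq_levelComponent hU hx ht
    have htr : 0 ≤ t ^ r := Real.rpow_nonneg ht r
    refine (smul_le_smul_of_nonneg_left (hp.le_levelComponent hw ht hpx) htr).trans ?_
    rw [← hc, ← map_smul]
    refine hb ⟨_, ⟨⟨smul_nonneg htr hc0, by rw [map_smul, hTc]⟩, t, i c, ht, ?_, ?_, ?_⟩, rfl⟩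
    · rw [hc]; exact isComponent_levelComponent hw x t
    · rw [hc]; exact smul_levelComponent_le hw hx.1 ht
    · rw [map_smul]
  have hsub : supClosure A ⊆ {f | 0 ≤ f ∧ T f = f} := by
    refine supClosure_min (fun a ha => ha.1) ?_
    rintro a ⟨ha, hTa⟩ b ⟨hb, hTb⟩
    refine ⟨ha.trans le_sup_left, hT.map_eq_of_fixed hU ?_⟩
    have h1 := IsPosExtension.map hU hT.orderContinuous ha
    have h2 := IsPosExtension.map hU hT.orderContinuous hb
    rw [hTa] at h1
    rw [hTb] at h2
    rw [hU.map_sup]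
    exact hT.fixed_sup hU h1 h2
  have hlA' := (isLUB_image_supClosure hU.map_sup).2 hlA
  refine .of_net hU hT.orderContinuous (A := supClosure A) ?_ supClosed_supClosure.directedOn
    (fun a ha => (hsub ha).1) hlA' ?_
  · refine ⟨0, subset_supClosure ⟨⟨le_rfl, map_zero T⟩, ?_⟩⟩
    rw [map_zero]
    exact zero_mem_stepPowers hw hx.1 r
  · rwa [Set.image_congr fun a ha => by rw [(hsub ha).2]]

lemma mem_condRange_of_fixed (hU : IsUniversalCompletion i) (hT : IsConditionalRieszTriple e T)
    {x : U} (hx : IsPosExtension i T x x) : x ∈ condRange i T :=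
  ⟨x, hx.mem_L1 hU hT.orderContinuous, hx.extend_eq hU hT.orderContinuous⟩

/-- `x` is a difference of two fixed elements and equals its own positive part. -/
lemma fixed_of_mem_condRange (hU : IsUniversalCompletion i) (hT : IsConditionalRieszTriple e T)
    {x : U} (hx : x ∈ condRange i T) (h0 : 0 ≤ x) : IsPosExtension i T x x := by
  obtain ⟨z, hz, rfl⟩ := hx
  obtain ⟨⟨v, hv⟩, w, hw⟩ := exists_isPosExtension_of_mem_L1 hU hT.orderContinuous hz
  rw [IsPosExtension.extend_sub_eq hv hw] at h0 ⊢
  have := hT.fixed_posPart_sub hU (hT.isPosExtension_idem hU hv) (hT.isPosExtension_idem hU hw)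
  rwa [posPart_of_nonneg h0] at this

end IsConditionalRieszTriple

/-! ### The extension of `S`: existence, fixed elements, powers. -/

namespace IsCondExpPreservingSystem

/-- The extension of `S` is defined on the natural domain of `T`. -/
lemma exists_isPosExtension (hU : IsUniversalCompletion i)
    (hS : IsCondExpPreservingSystem e T S) {x v : U} (h : IsPosExtension i T x v) :
    ∃ s, IsPosExtension i S x s := by
  have hT := hS.triple
  have hSO := hS.orderContinuous
  refine RieszErgodic.exists_isPosExtension h.1 ?_
  have hY : ∀ y ∈ imagesBelow i S x, 0 ≤ y := by
    rintro _ ⟨y, hy, -, rfl⟩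
    exact hU.map_nonneg_iff.2 (hSO.map_nonneg hy)
  refine bddAbove_of_laterallyComplete hU.laterallyComplete hY fun c hc => ?_
  obtain ⟨z, hz, hzc⟩ := hU.orderDense c hc
  have hiz : 0 ≤ i z := hU.map_nonneg_iff.2 hz.le
  -- Otherwise `T (n • z) = sup T (S y ⊓ n • z) ≤ sup T (S y) = sup T y = v` for all `n`, so `T z ≤
  -- 0`.
  obtain ⟨n, hn⟩ : ∃ n : ℕ, ¬ IsLUB ((fun y => i (S y ⊓ (n : ℝ) • z)) '' {y | 0 ≤ y ∧ i y ≤ x})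
      (i ((n : ℝ) • z)) := by
    by_contra! hall
    refine absurd (hT.strictlyPositive z hz) (not_lt_of_ge ?_)
    rw [← hU.map_le_map_iff, map_zero]
    refine nonpos_of_forall_natCast_smul_le (y := v) fun n => ?_
    have h1 := hU.isLUB_of_isLUB_map (A := (fun y => S y ⊓ (n : ℝ) • z) '' {y | 0 ≤ y ∧ i y ≤ x})
      (by rw [Set.image_image]; exact hall n)
    have h2 := hU.isLUB_map (hT.orderContinuous.isLUB_map ((below_nonempty h.1).image _) (by
      rintro _ ⟨a, ha, rfl⟩ _ ⟨b, hb, rfl⟩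
      obtain ⟨d, hd, had, hbd⟩ := directedOn_below hU x a ha b hb
      exact ⟨_, ⟨d, hd, rfl⟩, inf_le_inf_right _ (hSO.monotone had),
        inf_le_inf_right _ (hSO.monotone hbd)⟩) h1)
    rw [map_smul, map_smul] at h2
    refine h2.2 ?_
    rintro _ ⟨_, ⟨_, ⟨y, hy, rfl⟩, rfl⟩, rfl⟩
    refine (hU.monotone (hT.orderContinuous.monotone inf_le_left)).trans ?_
    rw [hS.preserving]
    exact h.2.1 ⟨y, hy.1, hy.2, rfl⟩
  obtain ⟨u, hu, hnu⟩ : ∃ u ∈ upperBounds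
      ((fun y => i (S y ⊓ (n : ℝ) • z)) '' {y | 0 ≤ y ∧ i y ≤ x}), ¬ i ((n : ℝ) • z) ≤ u := by
    by_contra! hall
    refine hn ⟨?_, hall⟩
    rintro _ ⟨y, hy, rfl⟩
    exact hU.monotone inf_le_right
  have hnz : 0 ≤ (n : ℝ) • z := smul_nonneg n.cast_nonneg hz.le
  have hinz : 0 ≤ i ((n : ℝ) • z) := hU.map_nonneg_iff.2 hnz
  have hu0 : 0 ≤ u := by simpa [inf_eq_left.2 hnz] using hu ⟨0, ⟨le_rfl, by simpa using h.1⟩, rfl⟩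
  have hn0 : n ≠ 0 := by
    rintro rfl
    exact hnu (by simpa using hu0)
  have hd0 := posPart_sub_pos_of_not_le hnu
  -- On the band of `d` every `S y` stays below `n • z`: `d ≤ (n • z - S y)⁺`, which is disjoint
  -- from `(S y - n • z)⁺`. The factor `n⁻¹` below brings `d` under `c`.
  set d := (i ((n : ℝ) • z) - u)⁺
  have hninv : (0 : ℝ) < (n : ℝ)⁻¹ := by positivity
  have hdz : d ≤ i ((n : ℝ) • z) := posPart_le_of_le (sub_le_self _ hu0) hinz
  refine ⟨(n : ℝ)⁻¹ • d, lt_of_le_of_ne (smul_nonneg hninv.le hd0.le)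
    (smul_ne_zero hninv.ne' hd0.ne').symm, ?_, i ((n : ℝ) • z), ?_⟩
  · refine le_trans ?_ hzc
    have := smul_le_smul_of_nonneg_left hdz hninv.le
    rwa [map_smul, smul_smul, inv_mul_cancel₀ (by positivity), one_smul] at this
  · rintro _ ⟨y, hy, hyx, rfl⟩ m
    have h1 : d ≤ (i ((n : ℝ) • z) - i (S y))⁺ := by
      rw [← sub_inf_eq_posPart_sub]
      refine posPart_le_of_le (sub_le_sub_left ?_ _) (sub_nonneg.2 inf_le_left)
      rw [inf_comm, ← hU.map_inf]
      exact hu ⟨y, ⟨hy, hyx⟩, rfl⟩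
    have h2 : (i (S y) - i ((n : ℝ) • z))⁺ ⊓ d = 0 := by
      have := posPart_inf_negPart_eq_zero (i (S y) - i ((n : ℝ) • z))
      rw [← posPart_neg, neg_sub] at this
      exact inf_eq_zero_mono this (posPart_nonneg _) hd0.le le_rfl h1
    have hmd : 0 ≤ (m : ℝ) • (n : ℝ)⁻¹ • d := by positivity
    have h3 : i (S y) ≤ i ((n : ℝ) • z) + (i (S y) - i ((n : ℝ) • z))⁺ :=
      sub_le_iff_le_add'.1 (le_posPart _)
    refine (inf_le_inf_right _ h3).trans ((add_inf_le_add hinz (posPart_nonneg _) hmd).trans ?_)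
    rw [inf_smul_eq_zero (inf_smul_eq_zero h2 hninv.le) m.cast_nonneg, add_zero]
    exact inf_le_left

/-- `T S = T` on the natural domain of `T`. -/
lemma isPosExtension_comp (hU : IsUniversalCompletion i)
    (hS : IsCondExpPreservingSystem e T S) {x s v : U} (hs : IsPosExtension i S x s)
    (h : IsPosExtension i T x v) : IsPosExtension i T s v := by
  have hSO := hS.orderContinuous
  refine .of_net hU hS.triple.orderContinuous (A := S '' {y | 0 ≤ y ∧ i y ≤ x})
    ((below_nonempty h.1).image _) ?_ ?_ ?_ ?_
  · rintro _ ⟨a, ha, rfl⟩ _ ⟨b, hb, rfl⟩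
    obtain ⟨c, hc, hac, hbc⟩ := directedOn_below hU x a ha b hb
    exact ⟨_, ⟨c, hc, rfl⟩, hSO.monotone hac, hSO.monotone hbc⟩
  · rintro _ ⟨a, ha, rfl⟩
    exact hSO.map_nonneg ha.1
  · rw [Set.image_image]
    exact hs.isLUB_image
  · rw [Set.image_image]
    simpa only [hS.preserving] using h.isLUB_image

lemma map_inf (hS : IsCondExpPreservingSystem e T S) (x y : E) : S (x ⊓ y) = S x ⊓ S y := by
  have h1 := congrArg S (inf_add_sup x y)
  rw [map_add, map_add, hS.map_sup, ← inf_add_sup (S x)] at h1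
  exact add_right_cancel h1

lemma isComponent_map (hS : IsCondExpPreservingSystem e T S) {c : E} (hc : IsComponent e c) :
    IsComponent e (S c) := by
  have := congrArg S hc
  rwa [hS.map_inf, map_sub, hS.map_unit, map_zero] at this

/-- `T (S c ⊓ (e - c)) ≤ c ⊓ (e - c) = 0`, so `S c ≤ c`; then `T (c - S c) = 0` gives equality. -/
lemma map_eq_of_isComponent (hS : IsCondExpPreservingSystem e T S) {c : E}
    (hc : IsComponent e c) (hTc : T c = c) : S c = c := by
  have hT := hS.triple
  have hm := hT.orderContinuous.monotone
  have hSc := hS.isComponent_map hc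
  have h0 : 0 ≤ (S c) ⊓ (e - c) := le_inf hSc.nonneg (sub_nonneg.2 hc.le)
  have h1 : S c ⊓ (e - c) = 0 := by
    refine hT.eq_zero_of_map_eq_zero h0 (le_antisymm ?_ (hT.orderContinuous.map_nonneg h0))
    have h2 := hm (inf_le_left : S c ⊓ (e - c) ≤ _)
    have h3 := hm (inf_le_right : S c ⊓ (e - c) ≤ _)
    rw [hS.preserving, hTc] at h2
    rw [map_sub, hT.map_unit, hTc] at h3
    exact (le_inf h2 h3).trans (le_of_eq hc)
  have hle : S c ≤ c := hSc.le_of_inf_sub_eq_zero hc.nonneg hc.le h1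
  have := hT.eq_zero_of_map_eq_zero (sub_nonneg.2 hle)
    (by rw [map_sub, hS.preserving, sub_self])
  exact (sub_eq_zero.1 this).symm

lemma isComponent_of_map (hU : IsUniversalCompletion i) {c : E} (h : IsComponent (i e) (i c)) :
    IsComponent e c := by
  apply hU.injective
  rwa [hU.map_inf, map_sub, map_zero]

lemma isComponent_map_of_isComponent (hU : IsUniversalCompletion i) {c : E}
    (h : IsComponent e c) : IsComponent (i e) (i c) := by
  rw [IsComponent, ← map_sub, ← hU.map_inf, h, map_zero]

/-- `S` fixes the range of `T`. -/
lemma fixed_of_fixed (hU : IsUniversalCompletion i) (hS : IsCondExpPreservingSystem e T S)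
    {x : U} (hx : IsPosExtension i T x x) : IsPosExtension i S x x := by
  have hT := hS.triple
  have hw := hU.isWeakOrderUnit_map hT.weakUnit
  obtain ⟨s, hs⟩ := hS.exists_isPosExtension hU hx
  have hle : x ≤ s := by
    refine le_of_forall_smul_levelComponent_le hw hx.1 fun t ht => ?_
    obtain ⟨c, hc0, hc, hTc⟩ := hT.exists_map_eq_levelComponent hU hx ht
    have hcc : IsComponent e c :=
      isComponent_of_map hU (by rw [hc]; exact isComponent_levelComponent hw.1 x t)
    have h1 := IsPosExtension.map hU hS.orderContinuous (smul_nonneg ht hc0)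
    rw [map_smul, map_smul, hS.map_eq_of_isComponent hcc hTc, map_smul, hc] at h1
    exact h1.mono hs (smul_levelComponent_le hw.1 hx.1 ht)
  have := hT.fixed_of_ge hU (hS.isPosExtension_comp hU hs hx) hle
  rwa [this] at hs

/-- The extension of `S` commutes with powers. -/
lemma isLUB_stepPowers (hU : IsUniversalCompletion i) (hS : IsCondExpPreservingSystem e T S)
    {x y p s : U} {q : ℝ} (hx : IsPosExtension i S x y)
    (hp : IsLUB (stepPowers (i e) q x) p) (hs : IsPosExtension i S p s) :
    IsLUB (stepPowers (i e) q y) s := by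
  have hSO := hS.orderContinuous
  have hw : 0 ≤ i e := hU.map_nonneg_iff.2 hS.triple.weakUnit.1
  have hlevel : ∀ t : ℝ, 0 ≤ t → ∃ c, i c = levelComponent (i e) x t ∧ IsComponent e c := by
    intro t ht
    obtain ⟨c, hc0, hc⟩ := hU.exists_map_eq (levelComponent_nonneg (i e) x t)
      (levelComponent_le hw x t)
    exact ⟨c, hc, isComponent_of_map hU (by rw [hc]; exact isComponent_levelComponent hw x t)⟩
  constructor
  · rintro _ ⟨t, r, ht, hr, hry, rfl⟩
    obtain ⟨c, hc, hcc⟩ := hlevel t ht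
    have htq : 0 ≤ t ^ q := Real.rpow_nonneg ht q
    -- `S` carries the level component of `x` to a component above every `r` with `t • r ≤ y`: by
    -- order continuity it respects the supremum defining `e - c`.
    have hrc : r ≤ i (S c) := by
      refine hr.le_of_inf_sub_eq_zero (hU.map_nonneg_iff.2 (hSO.map_nonneg hcc.nonneg))
        (hU.monotone (hS.isComponent_map hcc).le) ?_
      have hte : 0 ≤ t • e := smul_nonneg ht hS.triple.weakUnit.1
      -- Truncating `x` at `t • e` brings it into `E`, where `S` itself acts.
      obtain ⟨m, hm0, hm⟩ := hU.exists_map_eq (y := t • e)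
        (le_inf hx.1 (hU.map_nonneg_iff.2 hte)) inf_le_right
      have hyt : y ⊓ i (t • e) ≤ i (S m) := by
        refine inf_le_of_isLUB hx.2 ?_
        rintro _ ⟨a, ha, hax, rfl⟩
        have h1 : i (t • e) = i (S (t • e)) := by rw [map_smul S, hS.map_unit]
        rw [h1, ← hU.map_inf, ← hS.map_inf]
        refine hU.monotone (hSO.monotone ?_)
        rw [← hU.map_le_map_iff, hm, hU.map_inf]
        exact inf_le_inf_right _ hax
      have hD : r ⊓ i (S (t • e - m)) = 0 := by
        have hmt : m ≤ t • e := by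
          rw [← hU.map_le_map_iff, hm]; exact inf_le_right
        refine inf_eq_zero_mono (inf_smul_eq_zero hr ht) hr.nonneg
          (hU.map_nonneg_iff.2 (hSO.map_nonneg (sub_nonneg.2 hmt))) le_rfl ?_
        rw [map_sub, map_smul, hS.map_unit, map_sub, smul_sub, map_smul]
        refine sub_le_sub_left (le_trans (le_inf hry ?_) hyt) _
        rw [map_smul]
        exact smul_le_smul_of_nonneg_left hr.le ht
      have hl := isLUB_levelComponent (i e) x t
      have hpart : (t • i e - x)⁺ = i (t • e - m) := by
        rw [← sub_inf_eq_posPart_sub, map_sub, hm, map_smul, inf_comm]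
      rw [hpart, ← hc, ← map_sub] at hl
      have hlE : IsLUB (Set.range fun n : ℕ => e ⊓ (n : ℝ) • (t • e - m)) (e - c) := by
        apply hU.isLUB_of_isLUB_map
        rw [← Set.range_comp]
        convert hl using 3 with n
        simp only [Function.comp, hU.map_inf, map_smul]
      have hD0 : 0 ≤ t • e - m := sub_nonneg.2 (by
        rw [← hU.map_le_map_iff, hm]; exact inf_le_right)
      have hmono : Monotone fun n : ℕ => e ⊓ (n : ℝ) • (t • e - m) := fun a b hab =>
        inf_le_inf_left _ (smul_le_smul_of_nonneg_right (by exact_mod_cast hab) hD0)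
      have hlS := hU.isLUB_map (hSO.isLUB_map (Set.range_nonempty _)
        (directedOn_range.2 hmono.directed_le) hlE)
      rw [map_sub, hS.map_unit, map_sub] at hlS
      refine le_antisymm ?_ (le_inf hr.nonneg (sub_nonneg.2
        (hU.monotone (hS.isComponent_map hcc).le)))
      rw [inf_comm]
      refine inf_le_of_isLUB hlS ?_
      rintro _ ⟨_, ⟨_, ⟨n, rfl⟩, rfl⟩, rfl⟩
      rw [inf_comm]
      refine (inf_le_inf_left _ (hU.monotone (hSO.monotone inf_le_right))).trans ?_
      rw [map_smul, map_smul]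
      exact (inf_smul_eq_zero hD n.cast_nonneg).le
    refine (smul_le_smul_of_nonneg_left hrc htq).trans ?_
    have h1 := IsPosExtension.map hU hSO (smul_nonneg htq hcc.nonneg)
    rw [map_smul, map_smul, map_smul] at h1
    refine h1.mono hs (hp.1 ⟨t, i c, ht, isComponent_map_of_isComponent hU hcc, ?_, rfl⟩)
    rw [hc]
    exact smul_levelComponent_le hw hx.1 ht
  · intro b hb
    -- `A` contains the powered level steps of `x` and is sup-closed, so it is a net increasing to
    -- `p` with images under `S` bounded by `b`.
    set A : Set E := {f | 0 ≤ f ∧ i f ≤ p ∧ i (S f) ≤ b}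
    have hlA : IsLUB (i '' A) p := by
      refine ⟨by rintro _ ⟨a, ha, rfl⟩; exact ha.2.1, fun b' hb' => hp.2 ?_⟩
      rintro _ ⟨t, r, ht, hr, hrx, rfl⟩
      obtain ⟨c, hc, hcc⟩ := hlevel t ht
      have htq : 0 ≤ t ^ q := Real.rpow_nonneg ht q
      have htc : t • i c ≤ x := by
        rw [hc]
        exact smul_levelComponent_le hw hx.1 ht
      refine (smul_le_smul_of_nonneg_left (hr.le_levelComponent hw ht hrx) htq).trans ?_
      rw [← hc, ← map_smul]
      refine hb' ⟨_, ⟨smul_nonneg htq hcc.nonneg, ?_, ?_⟩, rfl⟩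
      · rw [map_smul]
        exact hp.1 ⟨t, i c, ht, isComponent_map_of_isComponent hU hcc, htc, rfl⟩
      · rw [map_smul, map_smul]
        refine hb ⟨t, i (S c), ht, isComponent_map_of_isComponent hU (hS.isComponent_map hcc), ?_,
          rfl⟩
        have h1 := IsPosExtension.map hU hSO (smul_nonneg ht hcc.nonneg)
        rw [map_smul, map_smul, map_smul] at h1
        exact h1.mono hx htc
    have hsc : SupClosed A := by
      rintro f ⟨hf, hfp, hfb⟩ g ⟨hg, hgp, hgb⟩
      refine ⟨hf.trans le_sup_left, ?_, ?_⟩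
      · rw [hU.map_sup]; exact sup_le hfp hgp
      · rw [hS.map_sup, hU.map_sup]; exact sup_le hfb hgb
    have hub := upperBounds_imagesBelow hU hSO (A := A)
      ⟨0, le_rfl, by simpa using hs.1, by
        simpa using hb (zero_mem_stepPowers hw hx.nonneg q)⟩
      hsc.directedOn (fun a ha => ha.1) hlA
    refine hs.2.2 ?_
    rw [hub]
    rintro _ ⟨a, ha, rfl⟩
    exact ha.2.2

end IsCondExpPreservingSystem

end Expectation

/-! ### The isometry on `L^q(T)` and on `L^∞(T)`. -/

section Isometry

variable {E : Type*} [AddCommGroup E] [ConditionallyCompleteLattice E] [IsOrderedAddMonoid E]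
  [Module ℝ E] [IsOrderedModule ℝ E]
variable {U : Type*} [AddCommGroup U] [ConditionallyCompleteLattice U] [IsOrderedAddMonoid U]
  [Module ℝ U] [IsOrderedModule ℝ U]
variable {i : E →ₗ[ℝ] U} {e : E} {T S : E →ₗ[ℝ] E}

namespace IsCondExpPreservingSystem

/-- `S` maps `L¹(T)` into itself and commutes with the absolute value there. -/
lemma extend_mem_L1 (hU : IsUniversalCompletion i) (hS : IsCondExpPreservingSystem e T S) {x : U}
    (hx : x ∈ L1 i T) :
    ExtendsTo i S x ∧ extend i S x ∈ L1 i T ∧ IsPosExtension i S |x| |extend i S x| := by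
  have hTO := hS.triple.orderContinuous
  have hSO := hS.orderContinuous
  obtain ⟨⟨v, hv⟩, w, hw⟩ := exists_isPosExtension_of_mem_L1 hU hTO hx
  obtain ⟨s, hs⟩ := hS.exists_isPosExtension hU hv
  obtain ⟨t, ht⟩ := hS.exists_isPosExtension hU hw
  -- Disjointness makes `s` and `t` the positive and negative parts of `Sx`.
  have hst : s ⊓ t = 0 := hs.inf_eq_zero hU hSO hS.map_sup ht (posPart_inf_negPart_eq_zero x)
  rw [IsPosExtension.extend_sub_eq hs ht]
  refine ⟨⟨⟨s, hs.2.1⟩, ⟨t, ht.2.1⟩⟩,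
    ⟨s, (mem_domCone_iff hU hTO).2 ⟨v, hS.isPosExtension_comp hU hs hv⟩,
      t, (mem_domCone_iff hU hTO).2 ⟨w, hS.isPosExtension_comp hU ht hw⟩, rfl⟩, ?_⟩
  rw [← posPart_add_negPart, ← posPart_add_negPart, posPart_sub_eq_of_disjoint hst,
    negPart_sub_eq_of_disjoint hst]
  exact hs.add hU hSO ht

theorem isometry_Lq (hU : IsUniversalCompletion i) (hS : IsCondExpPreservingSystem e T S) {q : ℝ}
    (hq : 1 ≤ q) {x : U} (hx : x ∈ Lq i e T q) :
    ExtendsTo i S x ∧ extend i S x ∈ Lq i e T q ∧ normLq i e T q x ∈ condRange i T ∧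
      normLq i e T q (extend i S x) = normLq i e T q x := by
  obtain ⟨hx1, hb, hp1⟩ := hx
  have hT := hS.triple
  have hTO := hT.orderContinuous
  have hw : 0 ≤ i e := hU.map_nonneg_iff.2 hT.weakUnit.1
  have hq0 : 0 < q := zero_lt_one.trans_le hq
  obtain ⟨hext, hy1, habs⟩ := hS.extend_mem_L1 hU hx1
  have hp := isLUB_power hw (abs_nonneg x) hb
  have hp0 : 0 ≤ power (i e) q |x| := hp.1 (zero_mem_stepPowers hw (abs_nonneg x) q)
  obtain ⟨v, hv⟩ := exists_isPosExtension_abs_of_mem_L1 hU hTO hp1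
  rw [abs_of_nonneg hp0] at hv
  obtain ⟨s, hs⟩ := hS.exists_isPosExtension hU hv
  have hsv := hS.isPosExtension_comp hU hs hv
  have hl := hS.isLUB_stepPowers hU habs hp hs
  have hpow : power (i e) q |extend i S x| = s :=
    hl.csSup_eq ⟨0, zero_mem_stepPowers hw (abs_nonneg _) q⟩
  refine ⟨hext, ⟨hy1, ⟨s, hl.1⟩, hpow ▸ hsv.mem_L1 hU hTO⟩, ?_, ?_⟩
  · rw [normLq, hv.extend_eq hU hTO]
    exact hT.mem_condRange_of_fixed hU (hT.fixed_power hU (hT.isPosExtension_idem hU hv)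
      (by positivity) ((div_le_one hq0).2 hq))
  · rw [normLq, normLq, hpow, hsv.extend_eq hU hTO, hv.extend_eq hU hTO]

theorem isometry_LInfty (hU : IsUniversalCompletion i) (hS : IsCondExpPreservingSystem e T S)
    {x : U} (hx : x ∈ LInfty i T) :
    ExtendsTo i S x ∧ extend i S x ∈ LInfty i T ∧ normLInfty i T x ∈ condRange i T ∧
      normLInfty i T (extend i S x) = normLInfty i T x := by
  obtain ⟨hx1, u, hu, hxu⟩ := hx
  have hT := hS.triple
  have hTO := hT.orderContinuous
  have hSO := hS.orderContinuous
  obtain ⟨hext, hy1, habs⟩ := hS.extend_mem_L1 hU hx1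
  obtain ⟨v, hv⟩ := exists_isPosExtension_abs_of_mem_L1 hU hTO hx1
  have hfix : ∀ {z b : U}, b ∈ condRange i T → |z| ≤ b → IsPosExtension i T b b :=
    fun hb hzb => hT.fixed_of_mem_condRange hU hb ((abs_nonneg _).trans hzb)
  have hiff : ∀ b ∈ condRange i T, (|extend i S x| ≤ b ↔ |x| ≤ b) := by
    intro b hb
    constructor
    -- `S (|x| ⊔ b) = |Sx| ⊔ b = b`; applying `T` gives `T (|x| ⊔ b) = b = T b`, and strict
    -- positivity yields `|x| ⊔ b = b`.
    · intro h
      have hbT := hfix hb h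
      have hbS := hS.fixed_of_fixed hU hbT
      obtain ⟨m, hm⟩ := (hv.add hU hTO hbT).exists_of_le ((abs_nonneg x).trans le_sup_left)
        (sup_le (le_add_of_nonneg_right hbT.1) (le_add_of_nonneg_left (abs_nonneg x)))
      have h1 := habs.sup hU hSO hS.map_sup hbS
      rw [sup_eq_right.2 h] at h1
      have h2 : b = m := (hS.isPosExtension_comp hU h1 hm).unique hbT |>.symm
      have h3 := hm.sub hU hTO hbT le_sup_right
      rw [← h2, sub_self] at h3
      have h4 := hT.eq_zero_of_isPosExtension_zero hU h3
      exact le_sup_left.trans (sub_eq_zero.1 h4).le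
    · intro h
      exact habs.mono (hS.fixed_of_fixed hU (hfix hb h)) h
  have hglb := isGLB_csInf (s := {u | u ∈ condRange i T ∧ |x| ≤ u}) ⟨u, hu, hxu⟩
    ⟨|x|, fun b hb => hb.2⟩
  refine ⟨hext, ⟨hy1, u, hu, (hiff u hu).2 hxu⟩, ?_, ?_⟩
  · exact hT.mem_condRange_of_fixed hU
      (hT.fixed_of_isGLB hU (A := {u | u ∈ condRange i T ∧ |x| ≤ u}) ⟨u, hu, hxu⟩
        (fun b hb => hfix hb.1 hb.2) hglb)
  · rw [normLInfty, normLInfty]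
    congr 1
    ext b
    exact and_congr_right (hiff b)

end IsCondExpPreservingSystem

end Isometry

end RieszErgodic

theorem mainTheorem5
    {E : Type*} [AddCommGroup E] [ConditionallyCompleteLattice E] [IsOrderedAddMonoid E]
    [Module ℝ E] [IsOrderedModule ℝ E]
    {U : Type*} [AddCommGroup U] [ConditionallyCompleteLattice U] [IsOrderedAddMonoid U]
    [Module ℝ U] [IsOrderedModule ℝ U]
    (i : E →ₗ[ℝ] U) (hU : RieszErgodic.IsUniversalCompletion i)
    (e : E) (T S : E →ₗ[ℝ] E) (hsys : RieszErgodic.IsCondExpPreservingSystem e T S) :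
    (∀ q : ℝ, 1 ≤ q → ∀ x ∈ RieszErgodic.Lq i e T q,
      RieszErgodic.ExtendsTo i S x ∧
      RieszErgodic.extend i S x ∈ RieszErgodic.Lq i e T q ∧
      RieszErgodic.normLq i e T q x ∈ RieszErgodic.condRange i T ∧
      RieszErgodic.normLq i e T q (RieszErgodic.extend i S x) =
        RieszErgodic.normLq i e T q x) ∧
    (∀ x ∈ RieszErgodic.LInfty i T,
      RieszErgodic.ExtendsTo i S x ∧
      RieszErgodic.extend i S x ∈ RieszErgodic.LInfty i T ∧
      RieszErgodic.normLInfty i T x ∈ RieszErgodic.condRange i T ∧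
      RieszErgodic.normLInfty i T (RieszErgodic.extend i S x) =
        RieszErgodic.normLInfty i T x) :=
  ⟨fun _ hq _ hx => hsys.isometry_Lq hU hq hx, fun _ hx => hsys.isometry_LInfty hU hx⟩
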